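/- Let $\|\cdot\|$ be the Euclidean norm on $\mathbb{R}^n$ and, for $1\le k\le n$, let $\Theta_k^{\uparrow}\subset\mathbb{R}^n$ be the set of all nondecreasing vectors with at most $k$ constant pieces: $\theta\in\Theta_k^{\uparrow}$ if and only if there are integers $0=a_0\le a_1\le\dots\le a_k=n$ and reals $\mu_1\le\dots\le\mu_k$ with $\theta_i=\mu_j$ whenever $a_{j-1}<i\le a_j$. For $\tau>0$ let $\mathrm{pen}_\tau(1)=\tau$ and $\mathrm{pen}_\tau(k)=\tau k\log\log(16n/k)$ for $2\le k\le n$. Theorem. Let $\epsilon\in(0,1)$ and $C_1>0$. There are constants $C_0>0$ and $C>0$, depending only on $\epsilon$ and $C_1$, such that the following holds for all $C'\ge C_0$, $n\ge 1$, $\sigma>0$ and $\theta^*\in\mathbb{R}^n$. Let $X=\theta^*+Z$, where $Z_1,\dots,Z_n$ are independent random variables with mean zero such that either $$\max_{1\le i\le n}\mathbb{E}|Z_i/\sigma|^{2+\epsilon}\le C_1,$$ or $Z_1,\dots,Z_n$ are identically distributed and $$\mathbb{E}\Big[\frac{Z_1^2}{\sigma^2}\log\Big(e+\frac{Z_1^2}{\sigma^2}\Big)\Big]\le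 C_1.$$ Put $\tau=C'\sigma^2$. For $1\le k\le n$ let $\widehat\theta(\Theta_k^{\uparrow})$ be any minimizer of $\|X-\theta\|^2$ over $\theta\in\Theta_k^{\uparrow}$, let $\widehat k$ be any minimizer of $\|X-\widehat\theta(\Theta_k^{\uparrow})\|^2+\mathrm{pen}_\tau(k)$ over $k\in\{1,\dots,n\}$, and let $\widehat\theta=\widehat\theta(\Theta_{\widehat k}^{\uparrow})$. Then $$\mathbb{E}\|\widehat\theta-\theta^*\|^2\le C\min_{1\le k\le n}\Big\{\inf_{\theta\in\Theta_k^{\uparrow}}\|\theta-\theta^*\|^2+\mathrm{pen}_\tau(k)\Big\}.$$ In particular, for every $k\in\{1,\dots,n\}$ such that $\theta^*\in\Theta_k^{\uparrow}$, one has $\mathbb{E}\|\widehat\theta-\theta^*\|^2\le C\,\mathrm{pen}_\tau(k)$, although $\widehat\theta$ does not use the knowledge of $k$. -/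

import Mathlib

open MeasureTheory ProbabilityTheory

namespace ReducedIsotonic

noncomputable section

/-- Nondecreasing vectors of length `n` with at most `k` constant pieces. The entry with 0-based
index `i : Fin n` is the entry `i + 1` of the vector; the pieces are the integer intervals
`(a (j-1), a j]`, which may be empty. -/
def Theta (n k : ℕ) : Set (EuclideanSpace ℝ (Fin n)) :=
  {θ | ∃ (a : Fin (k + 1) → ℕ) (m : Fin k → ℝ),
    a 0 = 0 ∧ a (Fin.last k) = n ∧ Monotone a ∧ Monotone m ∧
    ∀ (j : Fin k) (i : Fin n),
      a j.castSucc < (i : ℕ) + 1 → (i : ℕ) + 1 ≤ a j.succ → θ i = m j}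

/-- `θ` is a least squares fit of `x` in `S`, that is, an element of
`argmin_{θ' ∈ S} ‖x - θ'‖²`. -/
def IsLeastSquares {n : ℕ} (S : Set (EuclideanSpace ℝ (Fin n)))
    (x θ : EuclideanSpace ℝ (Fin n)) : Prop :=
  θ ∈ S ∧ ∀ θ' ∈ S, ‖x - θ‖ ^ 2 ≤ ‖x - θ'‖ ^ 2

/-- The penalty: `τ` for `k = 1`, and `τ k log log (16 n / k)` for `2 ≤ k ≤ n`. -/
def pen (τ : ℝ) (n k : ℕ) : ℝ :=
  if k = 1 then τ else τ * k * Real.log (Real.log (16 * n / k))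

/-- `k ∈ {1, …, n}` minimizes the penalized least squares criterion
`‖x - fit k‖² + pen τ n k` over `{1, …, n}`. -/
def IsPenalizedChoice {n : ℕ} (τ : ℝ) (fit : ℕ → EuclideanSpace ℝ (Fin n))
    (x : EuclideanSpace ℝ (Fin n)) (k : ℕ) : Prop :=
  k ∈ Finset.Icc 1 n ∧
    ∀ l ∈ Finset.Icc 1 n, ‖x - fit k‖ ^ 2 + pen τ n k ≤ ‖x - fit l‖ ^ 2 + pen τ n l

/-- `inf_{θ ∈ Θ_k} ‖θ - θ*‖²`, the approximation error of the model with `k` pieces. -/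
def approxError {n : ℕ} (k : ℕ) (θstar : EuclideanSpace ℝ (Fin n)) : ℝ :=
  ⨅ θ : Theta n k, ‖(θ : EuclideanSpace ℝ (Fin n)) - θstar‖ ^ 2

/-- `min_{1 ≤ k ≤ n} {inf_{θ ∈ Θ_k} ‖θ - θ*‖² + pen τ n k}`. -/
def oracleRisk {n : ℕ} (hn : 1 ≤ n) (τ : ℝ) (θstar : EuclideanSpace ℝ (Fin n)) : ℝ :=
  (Finset.Icc 1 n).inf' (Finset.nonempty_Icc.mpr hn) fun k => approxError k θstar + pen τ n k

/-- The noise `Z₁, …, Zₙ` consists of independent random variables of mean zero. -/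
structure IsCenteredIndepNoise {Ω : Type*} [MeasurableSpace Ω] (P : Measure Ω) {n : ℕ}
    (Z : Fin n → Ω → ℝ) : Prop where
  measurable : ∀ i, Measurable (Z i)
  indep : iIndepFun Z P
  integrable : ∀ i, Integrable (Z i) P
  mean_zero : ∀ i, ∫ ω, Z i ω ∂P = 0

/-- The moment condition at scale `σ`: either `max_i E|Z_i/σ|^(2+ε) ≤ C₁`, or the `Z_i` are
identically distributed and `E[(Z_i/σ)² log (e + (Z_i/σ)²)] ≤ C₁`. The expectations are those of
nonnegative random variables, with values in `[0, ∞]`. -/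
def MomentCondition {Ω : Type*} [MeasurableSpace Ω] (P : Measure Ω) {n : ℕ}
    (Z : Fin n → Ω → ℝ) (σ ε C₁ : ℝ) : Prop :=
  (∀ i, ∫⁻ ω, ENNReal.ofReal (|Z i ω / σ| ^ (2 + ε)) ∂P ≤ ENNReal.ofReal C₁) ∨
  ((∀ i j, IdentDistrib (Z i) (Z j) P P) ∧
    ∀ i, ∫⁻ ω, ENNReal.ofReal
      ((Z i ω / σ) ^ 2 * Real.log (Real.exp 1 + (Z i ω / σ) ^ 2)) ∂P ≤ ENNReal.ofReal C₁)

/-- The observation `X = θ* + Z`. -/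
def observation {Ω : Type*} {n : ℕ} (θstar : EuclideanSpace ℝ (Fin n)) (Z : Fin n → Ω → ℝ)
    (ω : Ω) : EuclideanSpace ℝ (Fin n) :=
  θstar + WithLp.toLp 2 fun i => Z i ω

/-- The risk `E ‖est(X) - θ*‖²`, with values in `[0, ∞]`, of an estimator `est` (a function of the
data) under `X = θ* + Z`. -/
def risk {Ω : Type*} [MeasurableSpace Ω] (P : Measure Ω) {n : ℕ}
    (θstar : EuclideanSpace ℝ (Fin n)) (Z : Fin n → Ω → ℝ)
    (est : EuclideanSpace ℝ (Fin n) → EuclideanSpace ℝ (Fin n)) : ENNReal :=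
  ∫⁻ ω, ENNReal.ofReal (‖est (observation θstar Z ω) - θstar‖ ^ 2) ∂P

end

end ReducedIsotonic

namespace ReducedIsotonic

/-! Fix `θ ∈ Theta n k` and let `θ'` be the selected fit, with `l` pieces. Comparing the penalized
criteria at `θ'` and `θ` leaves only the linear noise term `⟨Z, θ' - θ⟩`. It suffices to bound its
square, simultaneously for all `l` and all `θ' ∈ Theta n l`, by `‖θ' - θ‖² σ² (F + A (pen 1 n k +
pen 1 n l))`, where `A` is a constant and the random `F` has mean `O(k)` (`exists_noise_bound`). For
large `C'` the penalty of `l` absorbs the term in `l`, and `k ≤ pen 1 n k` absorbs `F`.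

The noise bound uses that `θ' - θ` is nondecreasing on each piece of `θ`. Its negative part read
forward and its positive part read backward are antitone and nonnegative. Summation by parts turns
the pairing of such a weight with the noise into a combination of partial sums, weighted by the
drops of the weight. Grouping the drops by dyadic blocks and applying Cauchy–Schwarz bounds the
squared pairing by the squared norm of the weight times the sum of `max |S_d|² / 2^r` over the
blocks that contain a drop (`sq_sum_mul_le_of_antitone`). Each such block costs a threshold `T` plus
its excess over `T`. Over all pieces there are at most about `k log (16 n / k)` blocks, and at most
`k + l + 1` of them contain a drop.

Take `T` proportional to `t = log log (16 n / k)`. The expected excess of a block is `O(exp (-t))`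
plus terms summable over the blocks of one piece, and `exp (-t) = 1 / log (16 n / k)` cancels the
number of blocks, so the total expected excess is `O(k)` (`integral_pieceExcess_le`). The charge `t
· min (k log (16 n / k)) (k + l + 1)` is of the order of the two penalties
(`loglog_mul_blocks_le_pen`). This fails for `k = l = 1`, where the penalty has no iterated
logarithm; but then `θ' - θ` is constant and Kolmogorov's inequality for the whole sum suffices.

For the excess of block `r`, the noise is truncated where its square exceeds `2^(r/2)`. The bounded
part is handled by Doob's inequality for exponentials, and the remainder by its second moment. The
remainders are summable over `r` as soon as the truncated second moments at the levels `2^q` have a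
uniform summable bound. Both moment conditions provide one (`MomentCondition.exists_tail_bound`). -/

/-! ### Deterministic bounds: monotone weights and dyadic blocks. -/

/-- The largest absolute value of a partial sum of `y` with at most `n` terms. -/
noncomputable def maxAbsSum (y : ℕ → ℝ) (n : ℕ) : ℝ :=
  partialSups (fun d => |∑ i ∈ Finset.range d, y i|) n

/-- The total excess over `T` of the normalized squared maxima
`max_{d ≤ min (2 ^ (r + 1)) N} |S_d| ^ 2 / 2 ^ r`, over the dyadic blocks of `{1, …, N}`. -/
noncomputable def blockExcess (T : ℝ) (y : ℕ → ℝ) (N : ℕ) : ℝ :=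
  ∑ r ∈ Finset.range (Nat.log 2 N + 1),
    max (maxAbsSum y (min (2 ^ (r + 1)) N) ^ 2 / 2 ^ r - T) 0

lemma abs_sum_le_maxAbsSum (y : ℕ → ℝ) {d n : ℕ} (h : d ≤ n) :
    |∑ i ∈ Finset.range d, y i| ≤ maxAbsSum y n :=
  le_partialSups_of_le (fun d => |∑ i ∈ Finset.range d, y i|) h

lemma maxAbsSum_nonneg (y : ℕ → ℝ) (n : ℕ) : 0 ≤ maxAbsSum y n :=
  (abs_nonneg _).trans (abs_sum_le_maxAbsSum y le_rfl)

lemma blockExcess_nonneg (T : ℝ) (y : ℕ → ℝ) (N : ℕ) : 0 ≤ blockExcess T y N :=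
  Finset.sum_nonneg fun _ _ => le_max_right _ _

lemma sum_range_mul_eq_sum_sub_mul_sum (y w : ℕ → ℝ) (n : ℕ) :
    ∑ d ∈ Finset.range n, y d * w d =
      ∑ d ∈ Finset.range n, (w d - w (d + 1)) * ∑ i ∈ Finset.range (d + 1), y i
        + w n * ∑ i ∈ Finset.range n, y i := by
  induction n with
  | zero => simp
  | succ n ih =>
    rw [Finset.sum_range_succ, ih, Finset.sum_range_succ (fun d => (w d - w (d + 1)) * _),
      Finset.sum_range_succ (fun i => y i)]
    ring

/-- Dyadic condensation: the value at the end of a dyadic block is at most every earlier value in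
it, so each term is at most twice the sum over the preceding block. -/
lemma sum_two_pow_mul_sq_le {w : ℕ → ℝ} (hw : Antitone w) (hw0 : ∀ d, 0 ≤ w d) (R : ℕ) :
    ∑ r ∈ Finset.range (R + 1), 2 ^ r * w (2 ^ r - 1) ^ 2 ≤
      2 * ∑ d ∈ Finset.range (2 ^ R), w d ^ 2 := by
  induction R with
  | zero => simp; nlinarith [sq_nonneg (w 0)]
  | succ R ih =>
    rw [Finset.sum_range_succ]
    have h1 : (2 ^ R : ℝ) * w (2 ^ (R + 1) - 1) ^ 2 ≤
        ∑ d ∈ Finset.Ico (2 ^ R) (2 ^ (R + 1)), w d ^ 2 := by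
      have : ∑ d ∈ Finset.Ico (2 ^ R) (2 ^ (R + 1)), w (2 ^ (R + 1) - 1) ^ 2 =
          (2 ^ R : ℝ) * w (2 ^ (R + 1) - 1) ^ 2 := by
        rw [Finset.sum_const, Nat.card_Ico, nsmul_eq_mul]
        congr 1
        have : 2 ^ (R + 1) - 2 ^ R = 2 ^ R := by rw [pow_succ]; omega
        rw [this]; push_cast; rfl
      rw [← this]
      refine Finset.sum_le_sum fun d hd => ?_
      rw [Finset.mem_Ico] at hd
      exact pow_le_pow_left₀ (hw0 _) (hw (by omega)) 2
    have h2 := Finset.sum_Ico_consecutive (fun d => w d ^ 2) (Nat.zero_le (2 ^ R))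
      (Nat.pow_le_pow_right (by norm_num : 2 > 0) (Nat.le_succ R))
    rw [Finset.range_eq_Ico] at ih ⊢
    rw [Finset.range_eq_Ico] at ih ⊢
    rw [Nat.succ_eq_add_one] at h2
    rw [← h2, pow_succ]
    rw [pow_succ] at h1
    linarith

lemma sum_mem_le_sum_excess {A : Finset ℕ} {R : ℕ} (hA : A ⊆ Finset.range R) (x : ℕ → ℝ)
    (T : ℝ) :
    ∑ r ∈ A, x r ≤ ∑ r ∈ Finset.range R, max (x r - T) 0 + T * A.card := by
  calc ∑ r ∈ A, x r ≤ ∑ r ∈ A, (max (x r - T) 0 + T) :=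
        Finset.sum_le_sum fun r _ => by linarith [le_max_left (x r - T) 0]
    _ = ∑ r ∈ A, max (x r - T) 0 + T * A.card := by
        rw [Finset.sum_add_distrib, Finset.sum_const, nsmul_eq_mul, mul_comm]
    _ ≤ _ := by
        gcongr

lemma sq_sum_mul_le_of_antitone {T : ℝ} (hT : 0 ≤ T) (y : ℕ → ℝ) {w : ℕ → ℝ} {N : ℕ}
    (hw : Antitone w) (hwN : ∀ d, N ≤ d → w d = 0) {m : ℕ}
    (hm : ((Finset.range N).filter fun d => w (d + 1) ≠ w d).card ≤ m) :
    (∑ d ∈ Finset.range N, y d * w d) ^ 2 ≤ 2 * (∑ d ∈ Finset.range N, w d ^ 2) *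
      (blockExcess T y N + T * (min (Nat.log 2 N + 1) m : ℕ)) := by
  have hw0 : ∀ d, 0 ≤ w d := fun d => by
    rw [← hwN (max d N) (le_max_right _ _)]; exact hw (le_max_left _ _)
  set D := (Finset.range N).filter fun d => w (d + 1) ≠ w d with hD
  -- Blocks without a drop of `w` vanish after summation by parts, so the threshold is charged only
  -- on `A`, whose size is bounded both by the number of blocks and by the number of drops.
  set A := D.image fun d => Nat.log 2 (d + 1) with hAdef
  have hA : A ⊆ Finset.range (Nat.log 2 N + 1) := by
    intro r hr
    obtain ⟨d, hd, rfl⟩ := Finset.mem_image.1 hr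
    have := Finset.mem_range.1 (Finset.mem_filter.1 hd).1
    exact Finset.mem_range.2 (Nat.lt_succ_of_le (Nat.log_mono_right this))
  have hAcard : A.card ≤ min (Nat.log 2 N + 1) m :=
    le_min ((Finset.card_le_card hA).trans (by simp)) (Finset.card_image_le.trans hm)
  set M : ℕ → ℝ := fun r => maxAbsSum y (min (2 ^ (r + 1)) N) with hM
  have hM0 : ∀ r, 0 ≤ M r := fun r => maxAbsSum_nonneg _ _
  have h1 : |∑ d ∈ Finset.range N, y d * w d| ≤ ∑ r ∈ A, w (2 ^ r - 1) * M r := by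
    rw [sum_range_mul_eq_sum_sub_mul_sum, hwN N le_rfl, zero_mul, add_zero]
    have e1 : ∑ d ∈ Finset.range N, (w d - w (d + 1)) * ∑ i ∈ Finset.range (d + 1), y i =
        ∑ d ∈ D, (w d - w (d + 1)) * ∑ i ∈ Finset.range (d + 1), y i := by
      rw [hD, Finset.sum_filter_of_ne]
      intro d _ h e
      simp [e] at h
    rw [e1]
    refine (Finset.abs_sum_le_sum_abs _ _).trans ?_
    have e2 : ∀ d ∈ D, |(w d - w (d + 1)) * ∑ i ∈ Finset.range (d + 1), y i| ≤
        (w d - w (d + 1)) * M (Nat.log 2 (d + 1)) := by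
      intro d hd
      have hdN := Finset.mem_range.1 (Finset.mem_filter.1 hd).1
      have hg : 0 ≤ w d - w (d + 1) := sub_nonneg.2 (hw (Nat.le_succ d))
      rw [abs_mul, abs_of_nonneg hg]
      refine mul_le_mul_of_nonneg_left (abs_sum_le_maxAbsSum y (le_min ?_ hdN)) hg
      exact (Nat.lt_pow_succ_log_self (by norm_num) _).le
    refine (Finset.sum_le_sum e2).trans ?_
    rw [← Finset.sum_fiberwise_of_maps_to (s := D) (t := A) (g := fun d => Nat.log 2 (d + 1))
      fun d hd => Finset.mem_image_of_mem _ hd]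
    refine Finset.sum_le_sum fun r _ => ?_
    have e3 : ∑ d ∈ D with Nat.log 2 (d + 1) = r, (w d - w (d + 1)) * M (Nat.log 2 (d + 1)) =
        (∑ d ∈ D with Nat.log 2 (d + 1) = r, (w d - w (d + 1))) * M r := by
      rw [Finset.sum_mul]
      refine Finset.sum_congr rfl fun d hd => ?_
      rw [(Finset.mem_filter.1 hd).2]
    rw [e3]
    refine mul_le_mul_of_nonneg_right ?_ (hM0 r)
    calc ∑ d ∈ D with Nat.log 2 (d + 1) = r, (w d - w (d + 1))
        ≤ ∑ d ∈ Finset.Ico (2 ^ r - 1) (2 ^ (r + 1) - 1), (w d - w (d + 1)) := by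
          refine Finset.sum_le_sum_of_subset_of_nonneg (fun d hd => ?_)
            fun d _ _ => sub_nonneg.2 (hw (Nat.le_succ d))
          have hr := (Finset.mem_filter.1 hd).2
          have a1 := Nat.pow_log_le_self 2 (x := d + 1) (by omega)
          have a2 := Nat.lt_pow_succ_log_self (b := 2) (by norm_num) (d + 1)
          rw [hr] at a1 a2
          rw [Finset.mem_Ico]
          omega
      _ = w (2 ^ r - 1) - w (2 ^ (r + 1) - 1) := by
          rw [Finset.sum_Ico_eq_sub _ (Nat.sub_le_sub_right
            (Nat.pow_le_pow_right (by norm_num) (Nat.le_succ r)) 1),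
            Finset.sum_range_sub', Finset.sum_range_sub']
          ring
      _ ≤ w (2 ^ r - 1) := by linarith [hw0 (2 ^ (r + 1) - 1)]
  -- Cauchy–Schwarz with weight `2^r`, which makes the first factor a condensed form of the squared
  -- norm of `w`.
  have h2 : (∑ r ∈ A, w (2 ^ r - 1) * M r) ^ 2 ≤
      (∑ r ∈ A, 2 ^ r * w (2 ^ r - 1) ^ 2) * ∑ r ∈ A, M r ^ 2 / 2 ^ r := by
    refine Finset.sum_sq_le_sum_mul_sum_of_sq_le_mul _ (fun _ _ => by positivity)
      (fun _ _ => by positivity) fun r _ => le_of_eq ?_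
    field_simp
  have h3 : ∑ r ∈ A, 2 ^ r * w (2 ^ r - 1) ^ 2 ≤ 2 * ∑ d ∈ Finset.range N, w d ^ 2 := by
    refine (Finset.sum_le_sum_of_subset_of_nonneg hA fun _ _ _ => by positivity).trans ?_
    refine (sum_two_pow_mul_sq_le hw hw0 _).trans ?_
    gcongr 2 * ?_
    rw [Finset.sum_subset (Finset.range_subset_range.2 (le_max_left N (2 ^ Nat.log 2 N)))
      (f := fun d => w d ^ 2)]
    · exact Finset.sum_le_sum_of_subset_of_nonneg
        (Finset.range_subset_range.2 (le_max_right _ _)) fun _ _ _ => sq_nonneg _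
    · intro d _ hd
      rw [Finset.mem_range, not_lt] at hd
      rw [hwN d hd]; ring
  have h4 := sum_mem_le_sum_excess hA (fun r => M r ^ 2 / 2 ^ r) T
  have h5 : ∑ r ∈ A, M r ^ 2 / 2 ^ r ≤ blockExcess T y N + T * (min (Nat.log 2 N + 1) m : ℕ) := by
    refine h4.trans (add_le_add le_rfl (mul_le_mul_of_nonneg_left ?_ hT))
    exact_mod_cast hAcard
  calc (∑ d ∈ Finset.range N, y d * w d) ^ 2 = |∑ d ∈ Finset.range N, y d * w d| ^ 2 :=
        (sq_abs _).symm
    _ ≤ (∑ r ∈ A, w (2 ^ r - 1) * M r) ^ 2 := pow_le_pow_left₀ (abs_nonneg _) h1 2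
    _ ≤ _ := h2
    _ ≤ _ := mul_le_mul h3 h5 (Finset.sum_nonneg fun _ _ => by positivity)
        (by positivity)

lemma sq_sum_mul_negPart_le {T : ℝ} (hT : 0 ≤ T) (z : ℕ → ℝ) {v : ℕ → ℝ} {N : ℕ}
    (hv : ∀ i j, i ≤ j → j < N → v i ≤ v j) {m : ℕ}
    (hm : ((Finset.range (N - 1)).filter fun d => v (d + 1) ≠ v d).card ≤ m) :
    (∑ d ∈ Finset.range N, z d * max (-v d) 0) ^ 2 ≤
      2 * (∑ d ∈ Finset.range N, max (-v d) 0 ^ 2) *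
        (blockExcess T z N + T * (min (Nat.log 2 N + 1) (m + 1) : ℕ)) := by
  set w : ℕ → ℝ := fun d => if d < N then max (-v d) 0 else 0 with hw
  have e1 : ∀ d ∈ Finset.range N, max (-v d) 0 = w d := fun d hd => by
    simp only [hw, if_pos (Finset.mem_range.1 hd)]
  have e2 : ∑ d ∈ Finset.range N, z d * max (-v d) 0 = ∑ d ∈ Finset.range N, z d * w d :=
    Finset.sum_congr rfl fun d hd => by rw [e1 d hd]
  have e3 : ∑ d ∈ Finset.range N, max (-v d) 0 ^ 2 = ∑ d ∈ Finset.range N, w d ^ 2 :=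
    Finset.sum_congr rfl fun d hd => by rw [e1 d hd]
  rw [e2, e3]
  refine sq_sum_mul_le_of_antitone hT z (w := w) ?_ (fun d hd => if_neg (not_lt.2 hd)) ?_
  · intro i j hij
    simp only [hw]
    by_cases hj : j < N
    · rw [if_pos hj, if_pos (hij.trans_lt hj)]
      exact max_le_max (neg_le_neg (hv i j hij hj)) le_rfl
    · rw [if_neg hj]
      split_ifs
      · exact le_max_right _ _
      · exact le_rfl
  -- Extending the weight by zero beyond `N` may create one further drop, at `N - 1`; hence `m + 1`.
  · have hsub : ((Finset.range N).filter fun d => w (d + 1) ≠ w d) ⊆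
        insert (N - 1) ((Finset.range (N - 1)).filter fun d => v (d + 1) ≠ v d) := by
      intro d hd
      obtain ⟨h1, h2⟩ := Finset.mem_filter.1 hd
      have h1 := Finset.mem_range.1 h1
      rw [Finset.mem_insert, Finset.mem_filter, Finset.mem_range]
      by_cases h : d = N - 1
      · exact Or.inl h
      · refine Or.inr ⟨by omega, fun h3 => h2 ?_⟩
        simp only [hw, if_pos h1, if_pos (show d + 1 < N by omega), h3]
    exact (Finset.card_le_card hsub).trans ((Finset.card_insert_le _ _).trans
      (Nat.succ_le_succ hm))

lemma sq_sum_mul_le_of_monotone {T : ℝ} (hT : 0 ≤ T) (z : ℕ → ℝ) {v : ℕ → ℝ} {N : ℕ}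
    (hv : ∀ i j, i ≤ j → j < N → v i ≤ v j) {m : ℕ}
    (hm : ((Finset.range (N - 1)).filter fun d => v (d + 1) ≠ v d).card ≤ m) :
    (∑ d ∈ Finset.range N, z d * v d) ^ 2 ≤
      (∑ d ∈ Finset.range N, v d ^ 2) *
        (2 * (blockExcess T z N + blockExcess T (fun d => z (N - 1 - d)) N +
          2 * T * (min (Nat.log 2 N + 1) (m + 1) : ℕ))) := by
  have hneg := sq_sum_mul_negPart_le hT z hv hm
  -- Reversal and change of sign keep the weight nondecreasing and turn its positive part into a
  -- negative part; a jump at `d` moves to `N - 2 - d`.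
  have hpos := sq_sum_mul_negPart_le hT (fun d => z (N - 1 - d)) (v := fun d => -v (N - 1 - d))
    (N := N) (fun i j hij hj => neg_le_neg (hv _ _ (by omega) (by omega))) (m := m) (by
      refine le_trans (Finset.card_le_card_of_injOn (fun d => N - 2 - d) ?_ ?_) hm
      · intro d hd
        obtain ⟨h1, h2⟩ := Finset.mem_filter.1 hd
        have h1 := Finset.mem_range.1 h1
        simp only [Finset.coe_filter, Finset.mem_range, Set.mem_ofPred_eq]
        refine ⟨by omega, fun h3 => h2 ?_⟩
        rw [show N - 1 - (d + 1) = N - 2 - d by omega, ← h3,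
          show N - 2 - d + 1 = N - 1 - d by omega]
      · intro d hd d' hd' h
        have h1 := Finset.mem_range.1 (Finset.mem_filter.1 hd).1
        have h1' := Finset.mem_range.1 (Finset.mem_filter.1 hd').1
        simp only at h
        omega)
  simp only [neg_neg] at hpos
  rw [Finset.sum_range_reflect (fun d => z d * max (v d) 0),
    Finset.sum_range_reflect (fun d => max (v d) 0 ^ 2)] at hpos
  have e1 : ∑ d ∈ Finset.range N, z d * v d = ∑ d ∈ Finset.range N, z d * max (v d) 0
      - ∑ d ∈ Finset.range N, z d * max (-v d) 0 := by
    rw [← Finset.sum_sub_distrib]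
    refine Finset.sum_congr rfl fun d _ => ?_
    rcases le_total 0 (v d) with h | h
    · rw [max_eq_left h, max_eq_right (neg_nonpos.2 h)]; ring
    · rw [max_eq_right h, max_eq_left (neg_nonneg.2 h)]; ring
  have e2 : ∑ d ∈ Finset.range N, v d ^ 2 = ∑ d ∈ Finset.range N, max (v d) 0 ^ 2
      + ∑ d ∈ Finset.range N, max (-v d) 0 ^ 2 := by
    rw [← Finset.sum_add_distrib]
    refine Finset.sum_congr rfl fun d _ => ?_
    rcases le_total 0 (v d) with h | h
    · rw [max_eq_left h, max_eq_right (neg_nonpos.2 h)]; ring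
    · rw [max_eq_right h, max_eq_left (neg_nonneg.2 h)]; ring
  rw [e1, e2]
  set a := ∑ d ∈ Finset.range N, z d * max (v d) 0
  set b := ∑ d ∈ Finset.range N, z d * max (-v d) 0
  set p := ∑ d ∈ Finset.range N, max (v d) 0 ^ 2 with hp
  set q := ∑ d ∈ Finset.range N, max (-v d) 0 ^ 2 with hq
  set Q := blockExcess T z N + T * (min (Nat.log 2 N + 1) (m + 1) : ℕ) with hQ
  set P := blockExcess T (fun d => z (N - 1 - d)) N + T * (min (Nat.log 2 N + 1) (m + 1) : ℕ)
    with hP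
  have hp0 : 0 ≤ p := Finset.sum_nonneg fun _ _ => sq_nonneg _
  have hq0 : 0 ≤ q := Finset.sum_nonneg fun _ _ => sq_nonneg _
  have hQ0 : 0 ≤ Q := add_nonneg (blockExcess_nonneg _ _ _) (by positivity)
  have hP0 : 0 ≤ P := add_nonneg (blockExcess_nonneg _ _ _) (by positivity)
  have h := Finset.sum_sq_le_sum_mul_sum_of_sq_le_mul Finset.univ (r := ![a, -b])
    (f := ![p, q]) (g := ![2 * P, 2 * Q]) (by simp [Fin.forall_fin_two, hp0, hq0])
    (by simp [Fin.forall_fin_two, hP0, hQ0])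
    (by
      simp only [Fin.forall_fin_two, Finset.mem_univ, true_imp_iff, Matrix.cons_val_zero,
        Matrix.cons_val_one]
      constructor <;> nlinarith)
  simp only [Fin.sum_univ_two, Matrix.cons_val_zero, Matrix.cons_val_one] at h
  rw [← sub_eq_add_neg] at h
  refine h.trans (le_of_eq ?_)
  rw [hP, hQ]; ring

/-! ### Gluing the bound over the pieces. -/

lemma sum_pieces_eq_sum_Ico {a : ℕ → ℕ} (ha : Monotone a) {M : Type*} [AddCommMonoid M]
    (f : ℕ → M) (k : ℕ) :
    ∑ j ∈ Finset.range k, ∑ d ∈ Finset.range (a (j + 1) - a j), f (a j + d) =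
      ∑ i ∈ Finset.Ico (a 0) (a k), f i := by
  induction k with
  | zero => simp
  | succ k ih =>
    rw [Finset.sum_range_succ, ih, ← Finset.sum_Ico_eq_sum_range,
      Finset.sum_Ico_consecutive _ (ha (Nat.zero_le k)) (ha (Nat.le_succ k))]

/-- The total block excess of the noise over the pieces `[a j, a (j + 1))`, each read forward and
backward. -/
noncomputable def pieceExcess (T : ℝ) (a : ℕ → ℕ) (k : ℕ) (z : ℕ → ℝ) : ℝ :=
  ∑ j ∈ Finset.range k, (blockExcess T (fun d => z (a j + d)) (a (j + 1) - a j) +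
    blockExcess T (fun d => z (a j + (a (j + 1) - a j - 1 - d))) (a (j + 1) - a j))

/-- Cauchy–Schwarz over the pieces combines the bounds of `sq_sum_mul_le_of_monotone`. The pieces
are disjoint, so the jumps inside them total at most `B.card`; the `+ k` collects the extra drop of
each piece. -/
lemma sq_sum_mul_le_pieceExcess {T : ℝ} (hT : 0 ≤ T) {a : ℕ → ℕ} (ha : Monotone a) {k n : ℕ}
    (h0 : a 0 = 0) (hk : a k = n) (z : ℕ → ℝ) {v : ℕ → ℝ}
    (hv : ∀ j < k, ∀ i i', a j ≤ i → i ≤ i' → i' < a (j + 1) → v i ≤ v i') {B : Finset ℕ}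
    (hB : ∀ j < k, ∀ i, a j ≤ i → i + 1 < a (j + 1) → v (i + 1) ≠ v i → i ∈ B) :
    (∑ i ∈ Finset.range n, z i * v i) ^ 2 ≤ (∑ i ∈ Finset.range n, v i ^ 2) *
      (2 * (pieceExcess T a k z + 2 * T *
        (min (∑ j ∈ Finset.range k, (Nat.log 2 (a (j + 1) - a j) + 1)) (B.card + k) : ℕ))) := by
  set m : ℕ → ℕ := fun j => ((Finset.range (a (j + 1) - a j)).filter fun d => a j + d ∈ B).card
    with hm
  have hmB : ∑ j ∈ Finset.range k, m j ≤ B.card := by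
    simp only [hm, Finset.card_filter]
    rw [sum_pieces_eq_sum_Ico ha (fun i => if i ∈ B then 1 else 0), ← Finset.card_filter]
    exact Finset.card_le_card fun i hi => (Finset.mem_filter.1 hi).2
  have hpiece : ∀ j ∈ Finset.range k,
      (∑ d ∈ Finset.range (a (j + 1) - a j), z (a j + d) * v (a j + d)) ^ 2 ≤
      (∑ d ∈ Finset.range (a (j + 1) - a j), v (a j + d) ^ 2) *
        (2 * (blockExcess T (fun d => z (a j + d)) (a (j + 1) - a j) +
          blockExcess T (fun d => z (a j + (a (j + 1) - a j - 1 - d))) (a (j + 1) - a j) +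
          2 * T * (min (Nat.log 2 (a (j + 1) - a j) + 1) (m j + 1) : ℕ))) := by
    intro j hj
    have hj := Finset.mem_range.1 hj
    refine sq_sum_mul_le_of_monotone hT (fun d => z (a j + d)) (v := fun d => v (a j + d))
      (fun i i' h h' => hv j hj _ _ (by omega) (by omega) (by omega)) ?_
    refine Finset.card_le_card fun d hd => ?_
    obtain ⟨h1, h2⟩ := Finset.mem_filter.1 hd
    have h1 := Finset.mem_range.1 h1
    exact Finset.mem_filter.2 ⟨Finset.mem_range.2 (by omega),
      hB j hj _ (by omega) (by omega) h2⟩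
  have h := Finset.sum_sq_le_sum_mul_sum_of_sq_le_mul (Finset.range k)
    (fun j _ => Finset.sum_nonneg fun _ _ => sq_nonneg _)
    (fun j _ => mul_nonneg zero_le_two (add_nonneg
      (add_nonneg (blockExcess_nonneg _ _ _) (blockExcess_nonneg _ _ _)) (by positivity))) hpiece
  rw [sum_pieces_eq_sum_Ico ha (fun i => z i * v i), sum_pieces_eq_sum_Ico ha (fun i => v i ^ 2),
    h0, hk, ← Finset.range_eq_Ico] at h
  refine h.trans (mul_le_mul_of_nonneg_left ?_ (Finset.sum_nonneg fun _ _ => sq_nonneg _))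
  rw [← Finset.mul_sum, Finset.sum_add_distrib, ← Finset.mul_sum, ← Nat.cast_sum]
  unfold pieceExcess
  gcongr
  refine le_min (Finset.sum_le_sum fun j _ => min_le_left _ _)
    ((Finset.sum_le_sum fun j _ => min_le_right _ _).trans ?_)
  rw [Finset.sum_add_distrib]
  simpa using hmB

/-! ### Maximal inequalities in mean square. -/

lemma partialSups_nat_succ (f : ℕ → ℝ) (n : ℕ) :
    partialSups f (n + 1) = max (partialSups f n) (f (n + 1)) :=
  partialSups_succ f n

section Doob

variable {Ω : Type*}

lemma measurable_partialSups_real {m : MeasurableSpace Ω} {f : ℕ → Ω → ℝ} {n : ℕ}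
    (hf : ∀ i ≤ n, Measurable[m] (f i)) :
    Measurable[m] fun ω => partialSups (fun i => f i ω) n := by
  induction n with
  | zero => simpa using hf 0 le_rfl
  | succ n ih =>
    simp_rw [partialSups_nat_succ]
    exact (ih fun i hi => hf i (by omega)).max (hf _ le_rfl)

/-- The information in the terms of `y` before the index `i`. -/
@[reducible] def past (y : ℕ → Ω → ℝ) (i : ℕ) : MeasurableSpace Ω :=
  ⨆ j : ℕ, ⨆ (_ : j < i), Real.measurableSpace.comap (y j)

lemma measurable_past {y : ℕ → Ω → ℝ} {i j : ℕ} (h : j < i) : Measurable[past y i] (y j) :=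
  Measurable.mono (comap_measurable (y j))
    (le_iSup₂ (f := fun j (_ : j < i) => Real.measurableSpace.comap (y j)) j h) le_rfl

lemma measurable_past_sum {y : ℕ → Ω → ℝ} {i d : ℕ} (h : d ≤ i) :
    Measurable[past y i] fun ω => ∑ j ∈ Finset.range d, y j ω :=
  Finset.measurable_sum _ fun _ hj => measurable_past ((Finset.mem_range.1 hj).trans_le h)

variable [mΩ : MeasurableSpace Ω] {P : Measure Ω}

lemma past_le {y : ℕ → Ω → ℝ} (hy : ∀ i, Measurable (y i)) (i : ℕ) : past y i ≤ mΩ :=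
  iSup₂_le fun j _ => (hy j).comap_le

lemma memLp_partialSups_real {f : ℕ → Ω → ℝ} {n : ℕ} (hf : ∀ i ≤ n, MemLp (f i) 2 P) :
    MemLp (fun ω => partialSups (fun i => f i ω) n) 2 P := by
  induction n with
  | zero => simpa using hf 0 le_rfl
  | succ n ih =>
    simp_rw [partialSups_nat_succ]
    exact (ih fun i hi => hf i (by omega)).sup (hf _ le_rfl)

/-- Doob's `L²` maximal inequality, with the submartingale property in integrated form. -/
lemma integral_partialSups_sq_le {f : ℕ → Ω → ℝ} {n : ℕ} (hf : ∀ i ≤ n, MemLp (f i) 2 P)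
    (hsub : ∀ i < n, 0 ≤ ∫ ω, partialSups (fun i => f i ω) i * (f (i + 1) ω - f i ω) ∂P) :
    ∫ ω, partialSups (fun i => f i ω) n ^ 2 ∂P ≤ 4 * ∫ ω, f n ω ^ 2 ∂P := by
  have hm : ∀ i ≤ n, MemLp (fun ω => partialSups (fun i => f i ω) i) 2 P := fun i hi =>
    memLp_partialSups_real fun j hj => hf j (hj.trans hi)
  have hmf : ∀ i ≤ n, ∀ j ≤ n, Integrable (fun ω => partialSups (fun i => f i ω) i * f j ω) P :=
    fun i hi j hj => (hm i hi).integrable_mul (hf j hj)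
  -- With `M` the running maximum, `M f - M² / 2` grows at each step by at least `M_i (f (i + 1) - f
  -- i)`, whose mean is nonnegative.
  have key : ∀ i ≤ n, 0 ≤ ∫ ω, (partialSups (fun i => f i ω) i * f i ω
      - partialSups (fun i => f i ω) i ^ 2 / 2) ∂P := by
    intro i
    induction i with
    | zero =>
      intro _
      refine integral_nonneg fun ω => ?_
      simp only [partialSups_zero, Pi.zero_apply]
      nlinarith [sq_nonneg (f 0 ω)]
    | succ i ih =>
      intro hi
      have h1 := ih (by omega)
      have h2 := hsub i (by omega)
      have i1 : Integrable (fun ω => partialSups (fun i => f i ω) i * f i ω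
          - partialSups (fun i => f i ω) i ^ 2 / 2) P :=
        (hmf i (by omega) i (by omega)).sub ((hm i (by omega)).integrable_sq.div_const 2)
      have i2 : Integrable (fun ω => partialSups (fun i => f i ω) i * (f (i + 1) ω - f i ω)) P := by
        simp_rw [mul_sub]
        exact (hmf i (by omega) _ hi).sub (hmf i (by omega) i (by omega))
      have i3 : Integrable (fun ω => partialSups (fun i => f i ω) (i + 1) * f (i + 1) ω
          - partialSups (fun i => f i ω) (i + 1) ^ 2 / 2) P :=
        (hmf _ hi _ hi).sub ((hm _ hi).integrable_sq.div_const 2)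
      refine (add_nonneg h1 h2).trans ?_
      rw [← integral_add i1 i2]
      refine integral_mono (i1.add i2) i3 fun ω => ?_
      simp only [partialSups_nat_succ]
      rcases le_total (partialSups (fun i => f i ω) i) (f (i + 1) ω) with h | h
      · rw [max_eq_right h]; nlinarith [sq_nonneg (partialSups (fun i => f i ω) i - f (i + 1) ω)]
      · rw [max_eq_left h]; nlinarith
  have hn := key n le_rfl
  have i1 := (hm n le_rfl).integrable_sq
  have i2 := (hf n le_rfl).integrable_sq
  have : ∫ ω, (partialSups (fun i => f i ω) n * f n ω
      - partialSups (fun i => f i ω) n ^ 2 / 2) ∂P ≤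
      ∫ ω, (f n ω ^ 2 - partialSups (fun i => f i ω) n ^ 2 / 4) ∂P := by
    refine integral_mono ((hmf n le_rfl n le_rfl).sub (i1.div_const 2))
      (i2.sub (i1.div_const 4)) fun ω => ?_
    simp only
    -- `M f ≤ f² + M² / 4`, which yields Doob's constant `4`.
    nlinarith [sq_nonneg (partialSups (fun i => f i ω) n - 2 * f n ω)]
  rw [integral_sub i2 (i1.div_const 4), integral_div] at this
  linarith

lemma indepFun_of_measurable_past {y : ℕ → Ω → ℝ} {N i : ℕ} (hy : ∀ i, Measurable (y i))
    (hind : iIndepFun (fun i : Fin N => y i) P) (hi : i < N) {g : Ω → ℝ}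
    (hg : Measurable[past y i] g) {h : ℝ → ℝ} (hh : Measurable h) :
    IndepFun g (fun ω => h (y i ω)) P := by
  have hind' : iIndep (fun j : Fin N => Real.measurableSpace.comap (y j)) P := hind
  have h1 := indep_iSup_of_disjoint (fun j : Fin N => (hy j).comap_le) hind'
    (S := {j | (j : ℕ) < i}) (T := {⟨i, hi⟩}) (by simp)
  rw [iSup_singleton] at h1
  rw [IndepFun_iff_Indep]
  refine indep_of_indep_of_le_left (indep_of_indep_of_le_right h1 ?_) ?_
  · exact (hh.comp (comap_measurable (y i))).comap_le
  · refine (measurable_iff_comap_le.1 hg).trans ?_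
    refine iSup₂_le fun j hj => ?_
    refine le_iSup_of_le (⟨j, hj.trans hi⟩ : Fin N) ?_
    exact le_iSup_of_le (show (⟨j, hj.trans hi⟩ : Fin N) ∈ {j : Fin N | (j : ℕ) < i} from hj) le_rfl

lemma integral_mul_eq_of_measurable_past {y : ℕ → Ω → ℝ} {N i : ℕ}
    (hy : ∀ i, Measurable (y i)) (hind : iIndepFun (fun i : Fin N => y i) P) (hi : i < N)
    {g : Ω → ℝ} (hg : Measurable[past y i] g) {h : ℝ → ℝ} (hh : Measurable h) :
    ∫ ω, g ω * h (y i ω) ∂P = (∫ ω, g ω ∂P) * ∫ ω, h (y i ω) ∂P :=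
  (indepFun_of_measurable_past hy hind hi hg hh).integral_fun_mul_eq_mul_integral
    (hg.mono (past_le hy i) le_rfl).aestronglyMeasurable
    (hh.comp (hy i)).aestronglyMeasurable

/-- Kolmogorov's maximal inequality in `L²`. -/
lemma integral_maxAbsSum_sq_le [IsProbabilityMeasure P] {y : ℕ → Ω → ℝ} {N : ℕ}
    (hy : ∀ i, Measurable (y i))
    (hind : iIndepFun (fun i : Fin N => y i) P) (hL : ∀ i, MemLp (y i) 2 P)
    (hmean : ∀ i, ∫ ω, y i ω ∂P = 0) {n : ℕ} (hn : n ≤ N) :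
    ∫ ω, maxAbsSum (fun i => y i ω) n ^ 2 ∂P ≤ 4 * ∑ i ∈ Finset.range n, ∫ ω, y i ω ^ 2 ∂P := by
  have hS : ∀ d, MemLp (fun ω => ∑ i ∈ Finset.range d, y i ω) 2 P := fun d =>
    memLp_finsetSum _ fun i _ => hL i
  have hindep : ∀ i < n, ∀ g : Ω → ℝ, Measurable[past y i] g → ∫ ω, g ω * y i ω ∂P = 0 := by
    intro i hi g hg
    have h := integral_mul_eq_of_measurable_past hy hind (hi.trans_le hn) hg measurable_id
    simpa [hmean i] using h
  unfold maxAbsSum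
  refine (integral_partialSups_sq_le (f := fun d ω => |∑ i ∈ Finset.range d, y i ω|)
    (fun d _ => (hS d).abs) ?_).trans ?_
  · intro i hi
    have hm : Measurable[past y i] fun ω =>
        partialSups (fun d => |∑ j ∈ Finset.range d, y j ω|) i :=
      measurable_partialSups_real fun d hd =>
        continuous_abs.measurable.comp (measurable_past_sum hd)
    -- The increment of `|S_i|` is at least `sgn (S_i) · y i`. Multiplied by the running maximum,
    -- the sign still depends only on the past, so this lower bound has mean zero.
    have hs : Measurable[past y i] fun ω =>
        if 0 ≤ ∑ j ∈ Finset.range i, y j ω then (1 : ℝ) else -1 :=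
      Measurable.ite (measurable_past_sum le_rfl measurableSet_Ici)
        measurable_const measurable_const
    have hms := hm.mul hs
    rw [← hindep i hi _ hms]
    have hmL : MemLp (fun ω => partialSups (fun d => |∑ j ∈ Finset.range d, y j ω|) i) 2 P :=
      memLp_partialSups_real fun d _ => (hS d).abs
    have hmsL := hmL.mono (hms.mono (past_le hy i) le_rfl).aestronglyMeasurable
      (Filter.Eventually.of_forall fun ω => by
        simp only [Pi.mul_apply, norm_mul]
        split_ifs <;> simp)
    refine integral_mono (hmsL.integrable_mul (hL i))
      (hmL.integrable_mul ((hS (i + 1)).abs.sub (hS i).abs)) fun ω => ?_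
    simp only [Pi.mul_apply]
    rw [mul_assoc]
    refine mul_le_mul_of_nonneg_left ?_ (maxAbsSum_nonneg (fun i => y i ω) i)
    rw [Finset.sum_range_succ]
    split_ifs with h
    · rw [abs_of_nonneg h]
      linarith [le_abs_self (∑ j ∈ Finset.range i, y j ω + y i ω)]
    · rw [abs_of_neg (not_le.1 h)]
      linarith [neg_abs_le (∑ j ∈ Finset.range i, y j ω + y i ω)]
  · simp only [sq_abs]
    refine mul_le_mul_of_nonneg_left (le_of_eq ?_) (by norm_num)
    clear hn
    induction n with
    | zero => simp
    | succ n ih =>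
      have hint : Integrable (fun ω => (∑ j ∈ Finset.range n, y j ω) * y n ω) P :=
        (hS n).integrable_mul (hL n)
      rw [Finset.sum_range_succ, ← ih fun i hi => hindep i (by omega)]
      have h0 := hindep n (Nat.lt_succ_self n) _ (measurable_past_sum le_rfl)
      simp_rw [Finset.sum_range_succ, add_sq, mul_assoc]
      have e1 := integral_add ((hS n).integrable_sq.add (hint.const_mul 2)) (hL n).integrable_sq
      have e2 := integral_add (hS n).integrable_sq (hint.const_mul 2)
      simp only [Pi.add_apply] at e1
      rw [e1, e2, integral_const_mul, h0]
      ring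

lemma memLp_maxAbsSum {y : ℕ → Ω → ℝ} (hL : ∀ i, MemLp (y i) 2 P) (n : ℕ) :
    MemLp (fun ω => maxAbsSum (fun i => y i ω) n) 2 P :=
  memLp_partialSups_real fun _ _ => (memLp_finsetSum _ fun i _ => hL i).abs

end Doob

/-! ### Exponential maximal inequality for bounded summands. -/

section Exponential

variable {Ω : Type*} [mΩ : MeasurableSpace Ω] {P : Measure Ω} [IsProbabilityMeasure P]

lemma memLp_exp_mul_of_abs_le {X : Ω → ℝ} (hX : Measurable X) {c : ℝ} (hc : ∀ ω, |X ω| ≤ c)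
    (s : ℝ) (p : ENNReal) : MemLp (fun ω => Real.exp (s * X ω)) p P := by
  refine MemLp.of_bound (hX.const_mul s).exp.aestronglyMeasurable (Real.exp (|s| * c))
    (Filter.Eventually.of_forall fun ω => ?_)
  rw [Real.norm_eq_abs, Real.abs_exp]
  refine Real.exp_le_exp.2 ((le_abs_self _).trans ?_)
  rw [abs_mul]
  exact mul_le_mul_of_nonneg_left (hc ω) (abs_nonneg s)

/-- Both bounds integrate elementary inequalities for a centred variable: `1 + u ≤ e^u`, and `e^u ≤
1 + u + u²` for `|u| ≤ 1`. The lower one provides the submartingale property in Doob's inequality.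
-/
lemma integral_exp_mul_bounds {X : Ω → ℝ} (hX : Measurable X) {c v s : ℝ}
    (hc : ∀ ω, |X ω| ≤ c) (hmean : ∫ ω, X ω ∂P = 0) (hv : ∫ ω, X ω ^ 2 ∂P ≤ v)
    (hs : |s| * c ≤ 1) :
    1 ≤ ∫ ω, Real.exp (s * X ω) ∂P ∧ ∫ ω, Real.exp (s * X ω) ∂P ≤ Real.exp (s ^ 2 * v) := by
  have hL : MemLp X 2 P := MemLp.of_bound hX.aestronglyMeasurable c
    (Filter.Eventually.of_forall hc)
  have hI : Integrable X P := hL.integrable (by norm_num)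
  have hE : Integrable (fun ω => Real.exp (s * X ω)) P :=
    memLp_one_iff_integrable.1 (memLp_exp_mul_of_abs_le hX hc s 1)
  constructor
  · have h1 : ∫ ω, (1 + s * X ω) ∂P = 1 := by
      rw [integral_add (integrable_const _) (hI.const_mul s), integral_const_mul, hmean]
      simp
    rw [← h1]
    refine integral_mono ((integrable_const _).add (hI.const_mul s)) hE fun ω => ?_
    simp only
    linarith [Real.add_one_le_exp (s * X ω)]
  · have h2 : ∫ ω, (1 + s * X ω + s ^ 2 * X ω ^ 2) ∂P = 1 + s ^ 2 * ∫ ω, X ω ^ 2 ∂P := by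
      have e1 := integral_add ((integrable_const (μ := P) (1 : ℝ)).add (hI.const_mul s))
        (hL.integrable_sq.const_mul (s ^ 2))
      have e2 := integral_add (integrable_const (μ := P) (1 : ℝ)) (hI.const_mul s)
      simp only [Pi.add_apply] at e1
      rw [e1, e2, integral_const_mul, integral_const_mul, hmean]
      simp
    calc ∫ ω, Real.exp (s * X ω) ∂P ≤ ∫ ω, (1 + s * X ω + s ^ 2 * X ω ^ 2) ∂P := by
          refine integral_mono hE (((integrable_const _).add (hI.const_mul s)).add
            (hL.integrable_sq.const_mul (s ^ 2))) fun ω => ?_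
          have hb : |s * X ω| ≤ 1 := by
            rw [abs_mul]
            exact (mul_le_mul_of_nonneg_left (hc ω) (abs_nonneg s)).trans hs
          have := (abs_le.1 (Real.abs_exp_sub_one_sub_id_le hb)).2
          simp only
          nlinarith
      _ = 1 + s ^ 2 * ∫ ω, X ω ^ 2 ∂P := h2
      _ ≤ s ^ 2 * v + 1 := by
          rw [add_comm]
          gcongr
      _ ≤ _ := Real.add_one_le_exp _

variable {y : ℕ → Ω → ℝ} {N : ℕ} {c v : ℝ}

lemma integral_partialSups_exp_sq_le (hy : ∀ i, Measurable (y i))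
    (hind : iIndepFun (fun i : Fin N => y i) P) (hc : ∀ i ω, |y i ω| ≤ c)
    (hmean : ∀ i, ∫ ω, y i ω ∂P = 0) (hv : ∀ i, ∫ ω, y i ω ^ 2 ∂P ≤ v) {s : ℝ}
    (hs : 2 * |s| * c ≤ 1) {n : ℕ} (hn : n ≤ N) :
    ∫ ω, partialSups (fun d => Real.exp (s * ∑ i ∈ Finset.range d, y i ω)) n ^ 2 ∂P ≤
      4 * Real.exp (4 * s ^ 2 * v * n) := by
  have hbd : ∀ d ω, |∑ i ∈ Finset.range d, y i ω| ≤ d * c := fun d ω => by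
    refine (Finset.abs_sum_le_sum_abs _ _).trans ?_
    refine (Finset.sum_le_sum fun i _ => hc i ω).trans (by simp)
  have hmeas : ∀ d, Measurable fun ω => ∑ i ∈ Finset.range d, y i ω := fun d =>
    Finset.measurable_sum _ fun i _ => hy i
  have hc0 : 0 ≤ c := by
    obtain ⟨ω⟩ := P.nonempty_of_neZero
    exact (abs_nonneg _).trans (hc 0 ω)
  have hL : ∀ d s, MemLp (fun ω => Real.exp (s * ∑ i ∈ Finset.range d, y i ω)) 2 P := fun d s =>
    memLp_exp_mul_of_abs_le (hmeas d) (hbd d) s 2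
  have hpast : ∀ d s, Measurable[past y d] fun ω =>
      Real.exp (s * ∑ i ∈ Finset.range d, y i ω) := fun d s =>
    Real.measurable_exp.comp ((measurable_const_mul s).comp (measurable_past_sum le_rfl))
  refine (integral_partialSups_sq_le
    (f := fun d ω => Real.exp (s * ∑ i ∈ Finset.range d, y i ω)) (fun d _ => hL d s) ?_).trans ?_
  · intro i hi
    have hm : Measurable[past y i] fun ω =>
        partialSups (fun d => Real.exp (s * ∑ j ∈ Finset.range d, y j ω)) i :=
      measurable_partialSups_real fun d hd =>
        Real.measurable_exp.comp ((measurable_const_mul s).comp (measurable_past_sum hd))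
    have h := integral_mul_eq_of_measurable_past hy hind (hi.trans_le hn)
      (hm.mul (hpast i s)) (h := fun x => Real.exp (s * x) - 1) (by fun_prop)
    have e : ∀ ω, partialSups (fun d => Real.exp (s * ∑ j ∈ Finset.range d, y j ω)) i *
        (Real.exp (s * ∑ j ∈ Finset.range (i + 1), y j ω) -
          Real.exp (s * ∑ j ∈ Finset.range i, y j ω)) =
        (partialSups (fun d => Real.exp (s * ∑ j ∈ Finset.range d, y j ω)) i *
          Real.exp (s * ∑ j ∈ Finset.range i, y j ω)) * (Real.exp (s * y i ω) - 1) := fun ω => by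
      rw [Finset.sum_range_succ, mul_add, Real.exp_add]
      ring
    simp_rw [e]
    refine le_of_le_of_eq (mul_nonneg ?_ ?_) h.symm
    · refine integral_nonneg fun ω => mul_nonneg ?_ (Real.exp_pos _).le
      exact (Real.exp_pos _).le.trans
        (le_partialSups (fun d => Real.exp (s * ∑ j ∈ Finset.range d, y j ω)) i)
    · have hE : Integrable (fun ω => Real.exp (s * y i ω)) P :=
        memLp_one_iff_integrable.1 (memLp_exp_mul_of_abs_le (hy i) (hc i) s 1)
      rw [integral_sub hE (integrable_const _)]
      have := (integral_exp_mul_bounds (hy i) (hc i) (hmean i) (hv i) (s := s)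
        (by nlinarith [mul_nonneg (abs_nonneg s) hc0])).1
      simpa using this
  · have e : ∀ d ω, Real.exp (s * ∑ i ∈ Finset.range d, y i ω) ^ 2 =
        Real.exp (2 * s * ∑ i ∈ Finset.range d, y i ω) := fun d ω => by
      rw [← Real.exp_nat_mul]; push_cast; ring_nf
    simp_rw [e]
    refine mul_le_mul_of_nonneg_left ?_ (by norm_num)
    induction n with
    | zero => simp
    | succ n ih =>
      have h := integral_mul_eq_of_measurable_past hy hind hn
        (hpast n (2 * s)) (h := fun x => Real.exp (2 * s * x)) (by fun_prop)
      have e : ∀ ω, Real.exp (2 * s * ∑ i ∈ Finset.range (n + 1), y i ω) =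
          Real.exp (2 * s * ∑ i ∈ Finset.range n, y i ω) * Real.exp (2 * s * y n ω) := fun ω => by
        rw [Finset.sum_range_succ, mul_add, Real.exp_add]
      simp_rw [e]
      rw [h]
      have h2 := (integral_exp_mul_bounds (hy n) (hc n) (hmean n) (hv n) (s := 2 * s)
        (by rw [abs_mul, abs_two]; exact hs)).2
      refine (mul_le_mul (ih (by omega)) h2
        (integral_nonneg fun _ => (Real.exp_pos _).le) (Real.exp_pos _).le).trans (le_of_eq ?_)
      rw [← Real.exp_add]
      push_cast
      ring_nf

lemma measurable_maxAbsSum (hy : ∀ i, Measurable (y i)) (n : ℕ) :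
    Measurable fun ω => maxAbsSum (fun i => y i ω) n :=
  measurable_partialSups_real fun _ _ =>
    continuous_abs.measurable.comp (Finset.measurable_sum _ fun i _ => hy i)

lemma integral_exp_maxAbsSum_le (hy : ∀ i, Measurable (y i))
    (hind : iIndepFun (fun i : Fin N => y i) P) (hc : ∀ i ω, |y i ω| ≤ c)
    (hmean : ∀ i, ∫ ω, y i ω ∂P = 0) (hv : ∀ i, ∫ ω, y i ω ^ 2 ∂P ≤ v) {s : ℝ} (hs0 : 0 ≤ s)
    (hs : s * c ≤ 1) {n : ℕ} (hn : n ≤ N) :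
    Integrable (fun ω => Real.exp (s * maxAbsSum (fun i => y i ω) n)) P ∧
    ∫ ω, Real.exp (s * maxAbsSum (fun i => y i ω) n) ∂P ≤ 8 * Real.exp (s ^ 2 * v * n) := by
  have hbd : ∀ d ω, |∑ i ∈ Finset.range d, y i ω| ≤ d * c := fun d ω => by
    refine (Finset.abs_sum_le_sum_abs _ _).trans ?_
    refine (Finset.sum_le_sum fun i _ => hc i ω).trans (by simp)
  have hmeas : ∀ d, Measurable fun ω => ∑ i ∈ Finset.range d, y i ω := fun d =>
    Finset.measurable_sum _ fun i _ => hy i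
  have hc0 : 0 ≤ c := by
    obtain ⟨ω⟩ := P.nonempty_of_neZero
    exact (abs_nonneg _).trans (hc 0 ω)
  have hI : Integrable (fun ω => Real.exp (s * maxAbsSum (fun i => y i ω) n)) P := by
    refine memLp_one_iff_integrable.1 (memLp_exp_mul_of_abs_le (measurable_maxAbsSum hy n)
      (c := n * c) (fun ω => ?_) s 1)
    rw [abs_of_nonneg (maxAbsSum_nonneg _ _)]
    refine partialSups_le _ _ _ fun d hd => (hbd d ω).trans ?_
    gcongr
  have hint : ∀ r : ℝ, Integrable (fun ω =>
      partialSups (fun d => Real.exp (r * ∑ i ∈ Finset.range d, y i ω)) n ^ 2) P := fun r =>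
    (memLp_partialSups_real fun d _ => memLp_exp_mul_of_abs_le (hmeas d) (hbd d) r 2).integrable_sq
  refine ⟨hI, ?_⟩
  -- The exponential at `s` is the square of the one at `s / 2`, so the `L²` inequality applies. The
  -- two signs account for `8 = 4 + 4`.
  have h1 := integral_partialSups_exp_sq_le hy hind hc hmean hv (s := s / 2)
    (by rw [abs_of_nonneg (by positivity)]; linarith) hn
  have h2 := integral_partialSups_exp_sq_le hy hind hc hmean hv (s := -(s / 2))
    (by rw [abs_neg, abs_of_nonneg (by positivity)]; linarith) hn
  have h3 : ∫ ω, Real.exp (s * maxAbsSum (fun i => y i ω) n) ∂P ≤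
      ∫ ω, (partialSups (fun d => Real.exp (s / 2 * ∑ i ∈ Finset.range d, y i ω)) n ^ 2 +
        partialSups (fun d => Real.exp (-(s / 2) * ∑ i ∈ Finset.range d, y i ω)) n ^ 2) ∂P := by
    refine integral_mono hI ((hint _).add (hint _)) fun ω => ?_
    obtain ⟨d, hd, he⟩ := exists_partialSups_eq (fun d => |∑ i ∈ Finset.range d, y i ω|) n
    have hsq : ∀ r : ℝ, Real.exp (2 * r * ∑ i ∈ Finset.range d, y i ω) ≤
        partialSups (fun d => Real.exp (r * ∑ i ∈ Finset.range d, y i ω)) n ^ 2 := fun r => by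
      have := le_partialSups_of_le (fun d => Real.exp (r * ∑ i ∈ Finset.range d, y i ω)) hd
      refine le_trans (le_of_eq ?_) (pow_le_pow_left₀ (Real.exp_pos _).le this 2)
      rw [← Real.exp_nat_mul]; push_cast; ring_nf
    simp only [maxAbsSum, he]
    rcases abs_cases (∑ i ∈ Finset.range d, y i ω) with ⟨h, -⟩ | ⟨h, -⟩
    · rw [h]
      have := hsq (s / 2)
      rw [show 2 * (s / 2) = s by ring] at this
      exact this.trans (le_add_of_nonneg_right (sq_nonneg _))
    · rw [h]
      have := hsq (-(s / 2))
      rw [show 2 * -(s / 2) * ∑ i ∈ Finset.range d, y i ω =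
        s * -∑ i ∈ Finset.range d, y i ω by ring] at this
      exact this.trans (le_add_of_nonneg_left (sq_nonneg _))
  rw [integral_add (hint _) (hint _)] at h3
  rw [show 4 * (-(s / 2)) ^ 2 * v * (n : ℝ) = s ^ 2 * v * n by ring] at h2
  rw [show 4 * (s / 2) ^ 2 * v * (n : ℝ) = s ^ 2 * v * n by ring] at h1
  linarith

end Exponential

/-! ### Expected excess of the dyadic blocks. -/

lemma max_sq_sub_sq_le_exp {W B κ : ℝ} (hW : 0 ≤ W) (hB : 0 ≤ B) (hκ : 1 / 2 ≤ κ) :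
    max (W ^ 2 - B ^ 2) 0 ≤ (8 + 4 * B) * Real.exp (κ * (W - B)) := by
  refine max_le ?_ (by positivity)
  rcases le_total W B with h | h
  · exact (by nlinarith : W ^ 2 - B ^ 2 ≤ 0).trans (by positivity)
  · have h0 : 0 ≤ W - B := sub_nonneg.2 h
    have hu : (W - B) / 2 ≤ κ * (W - B) := by nlinarith
    have h1 : 1 + (W - B) / 2 + ((W - B) / 2) ^ 2 / 2 ≤ Real.exp (κ * (W - B)) :=
      (Real.quadratic_le_exp_of_nonneg (by positivity)).trans (Real.exp_le_exp.2 hu)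
    have h2 : (8 + 4 * B) * (1 + (W - B) / 2 + ((W - B) / 2) ^ 2 / 2) ≤
        (8 + 4 * B) * Real.exp (κ * (W - B)) := mul_le_mul_of_nonneg_left h1 (by positivity)
    refine le_trans ?_ h2
    nlinarith [mul_nonneg hB (sq_nonneg (W - B)), mul_nonneg hB h0]

section Block

variable {Ω : Type*} [mΩ : MeasurableSpace Ω] {P : Measure Ω} [IsProbabilityMeasure P]
  {y : ℕ → Ω → ℝ} {N : ℕ}

lemma integral_max_sq_sub_le_of_bounded {v t : ℝ} (hv0 : 0 ≤ v) (ht : 1 ≤ t) (r : ℕ)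
    (hy : ∀ i, Measurable (y i))
    (hind : iIndepFun (fun i : Fin N => y i) P)
    (hc : ∀ i ω, |y i ω| ≤ 2 * √(2 ^ (r / 2)))
    (hmean : ∀ i, ∫ ω, y i ω ∂P = 0) (hv : ∀ i, ∫ ω, y i ω ^ 2 ∂P ≤ v)
    {n : ℕ} (hn : n ≤ N) (hn' : n ≤ 2 ^ (r + 1)) :
    Integrable (fun ω =>
      max (maxAbsSum (fun i => y i ω) n ^ 2 / 2 ^ r - (2 * v + 3) ^ 2 * t) 0) P ∧
    ∫ ω, max (maxAbsSum (fun i => y i ω) n ^ 2 / 2 ^ r - (2 * v + 3) ^ 2 * t) 0 ∂P ≤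
      64 * (2 * v + 4) * (Real.exp (-t) + Real.exp (-√(2 ^ (r / 2)))) := by
  set b : ℝ := √(2 ^ (r / 2)) with hb
  set ρ : ℝ := √(2 ^ r) with hρ
  set β : ℝ := 2 * v + 3 with hβ
  -- `√t` is the natural Chernoff parameter for the level `√t`; the cap `b / 2` ensures that `κ / ρ`
  -- times the bound `2 b` on the summands is at most `b² / ρ ≤ 1`.
  set κ : ℝ := min (√t) (b / 2) with hκ
  have hb1 : 1 ≤ b := Real.one_le_sqrt.2 (one_le_pow₀ (by norm_num))
  have hst : 1 ≤ √t := Real.one_le_sqrt.2 ht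
  have hst2 : √t ^ 2 = t := Real.sq_sqrt (by linarith)
  have hb2 : b ^ 2 = 2 ^ (r / 2) := Real.sq_sqrt (by positivity)
  have hρ2 : ρ ^ 2 = 2 ^ r := Real.sq_sqrt (by positivity)
  have hρ0 : 0 < ρ := Real.sqrt_pos.2 (by positivity)
  have hκ2 : 1 / 2 ≤ κ := le_min (by linarith) (by linarith)
  have hκt : κ ≤ √t := min_le_left _ _
  have hκb : κ ≤ b / 2 := min_le_right _ _
  have hbρ : b ^ 2 ≤ ρ := by
    rw [hb2]
    refine Real.le_sqrt_of_sq_le ?_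
    rw [← pow_mul]
    exact pow_le_pow_right₀ (by norm_num) (Nat.div_mul_le_self r 2)
  obtain ⟨hI, hE⟩ := integral_exp_maxAbsSum_le hy hind hc hmean hv (s := κ / ρ)
    (by positivity) (by
      rw [div_mul_eq_mul_div, div_le_one hρ0]
      nlinarith) hn
  have hpt : ∀ ω, max (maxAbsSum (fun i => y i ω) n ^ 2 / 2 ^ r - β ^ 2 * t) 0 ≤
      (8 + 4 * (β * √t)) * Real.exp (-(κ * (β * √t))) *
        Real.exp (κ / ρ * maxAbsSum (fun i => y i ω) n) := fun ω => by
    have h := max_sq_sub_sq_le_exp (W := maxAbsSum (fun i => y i ω) n / ρ) (B := β * √t)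
      (div_nonneg (maxAbsSum_nonneg _ _) hρ0.le) (by positivity) hκ2
    rw [div_pow, hρ2, mul_pow, hst2] at h
    refine h.trans (le_of_eq ?_)
    rw [mul_assoc, ← Real.exp_add]
    congr 2
    ring
  have hM := measurable_maxAbsSum hy n
  have hI' : Integrable (fun ω =>
      max (maxAbsSum (fun i => y i ω) n ^ 2 / 2 ^ r - β ^ 2 * t) 0) P := by
    refine (hI.const_mul ((8 + 4 * (β * √t)) * Real.exp (-(κ * (β * √t))))).mono'
      ((((hM.pow_const 2).div_const _).sub_const _).max measurable_const).aestronglyMeasurable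
      (Filter.Eventually.of_forall fun ω => ?_)
    rw [Real.norm_of_nonneg (le_max_right _ _)]
    exact hpt ω
  refine ⟨hI', ?_⟩
  refine (integral_mono hI' (hI.const_mul _) hpt).trans ?_
  rw [integral_const_mul]
  -- The level gives `exp (-(2 v + 3) x)`; the moment generating function costs `exp (2 v x)` and
  -- the polynomial prefactor `exp x`, which leaves `exp (-2 x)`.
  set x := κ * √t with hx
  have hx0 : 0 ≤ x := by positivity
  have e1 : (κ / ρ) ^ 2 * v * n ≤ 2 * v * x := by
    have hnr : (n : ℝ) ≤ 2 * ρ ^ 2 := by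
      rw [hρ2]
      have : (n : ℝ) ≤ 2 ^ (r + 1) := by exact_mod_cast hn'
      rw [pow_succ] at this
      linarith
    calc (κ / ρ) ^ 2 * v * n ≤ (κ / ρ) ^ 2 * v * (2 * ρ ^ 2) := by gcongr
      _ = 2 * v * (κ * κ) := by field_simp
      _ ≤ 2 * v * x := by rw [hx]; gcongr
  have e2 : 8 + 4 * (β * √t) ≤ 8 * (2 * v + 4) * Real.exp x := by
    have h1 : √t ≤ 2 * x := by rw [hx]; nlinarith
    have h2 := Real.add_one_le_exp x
    have h3 : 4 * (β * √t) ≤ 4 * (β * (2 * x)) := by gcongr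
    have h4 : 8 * (2 * v + 4) * (x + 1) ≤ 8 * (2 * v + 4) * Real.exp x := by gcongr
    refine le_trans ?_ h4
    rw [hβ] at h3 ⊢
    nlinarith [mul_nonneg hv0 hx0]
  have e3 : Real.exp (-(2 * x)) ≤ Real.exp (-t) + Real.exp (-b) := by
    rcases min_choice (√t) (b / 2) with h | h
    · have : x = t := by rw [hx, hκ, h, ← sq, hst2]
      have h5 : Real.exp (-(2 * x)) ≤ Real.exp (-t) := Real.exp_le_exp.2 (by linarith)
      linarith [Real.exp_pos (-b)]
    · have : x = b / 2 * √t := by rw [hx, hκ, h]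
      have h5 : Real.exp (-(2 * x)) ≤ Real.exp (-b) := Real.exp_le_exp.2 (by nlinarith)
      linarith [Real.exp_pos (-t)]
  calc (8 + 4 * (β * √t)) * Real.exp (-(κ * (β * √t))) *
        ∫ ω, Real.exp (κ / ρ * maxAbsSum (fun i => y i ω) n) ∂P
      ≤ (8 * (2 * v + 4) * Real.exp x) * Real.exp (-(κ * (β * √t))) *
        (8 * Real.exp (2 * v * x)) := by
        have := hE.trans (mul_le_mul_of_nonneg_left (Real.exp_le_exp.2 e1) (by norm_num))
        gcongr
    _ = 64 * (2 * v + 4) * Real.exp (-(2 * x)) := by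
        have : Real.exp (-(2 * x)) =
            Real.exp x * Real.exp (-(κ * (β * √t))) * Real.exp (2 * v * x) := by
          rw [← Real.exp_add, ← Real.exp_add]
          congr 1
          rw [hβ, hx]; ring
        rw [this]; ring
    _ ≤ _ := by gcongr

lemma maxAbsSum_add_le (u w : ℕ → ℝ) (n : ℕ) :
    maxAbsSum (fun i => u i + w i) n ≤ maxAbsSum u n + maxAbsSum w n := by
  refine partialSups_le _ _ _ fun d hd => ?_
  rw [Finset.sum_add_distrib]
  exact (abs_add_le _ _).trans (add_le_add (abs_sum_le_maxAbsSum _ hd) (abs_sum_le_maxAbsSum _ hd))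

lemma integral_sub_mean_sq_le {X : Ω → ℝ} (hX : MemLp X 2 P) :
    ∫ ω, (X ω - ∫ ω', X ω' ∂P) ^ 2 ∂P ≤ ∫ ω, X ω ^ 2 ∂P := by
  rw [← variance_eq_integral hX.aestronglyMeasurable.aemeasurable]
  exact variance_le_expectation_sq hX.aestronglyMeasurable

/-- Truncate and recentre both parts. The exponential bound controls the bounded part and
Kolmogorov's inequality the rest; `(a + b)² ≤ 2 a² + 2 b²` explains the doubled threshold. -/
lemma integral_max_sq_sub_le {D t : ℝ} {δ : ℕ → ℝ} (ht : 1 ≤ t) (r : ℕ)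
    (hy : ∀ i, Measurable (y i)) (hind : iIndepFun (fun i : Fin N => y i) P)
    (hL : ∀ i, MemLp (y i) 2 P) (hmean : ∀ i, ∫ ω, y i ω ∂P = 0)
    (hD : ∀ i, ∫ ω, y i ω ^ 2 ∂P ≤ D)
    (hδ : ∀ i q, ∫ ω, (if 2 ^ q < y i ω ^ 2 then y i ω ^ 2 else 0) ∂P ≤ δ q)
    {n : ℕ} (hn : n ≤ N) (hn' : n ≤ 2 ^ (r + 1)) :
    Integrable (fun ω =>
      max (maxAbsSum (fun i => y i ω) n ^ 2 / 2 ^ r - 2 * (2 * D + 3) ^ 2 * t) 0) P ∧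
    ∫ ω, max (maxAbsSum (fun i => y i ω) n ^ 2 / 2 ^ r - 2 * (2 * D + 3) ^ 2 * t) 0 ∂P ≤
      128 * (2 * D + 4) * (Real.exp (-t) + Real.exp (-√(2 ^ (r / 2)))) + 16 * δ (r / 2) := by
  have hD0 : 0 ≤ D := (integral_nonneg fun ω => sq_nonneg (y 0 ω)).trans (hD 0)
  -- The level is high enough for the tails to be summable over `r`, and low enough for the summands
  -- to be of order at most `2^(r/4)`, well below the scale `2^(r/2)` of the partial sums.
  set q := r / 2 with hq
  set lo : ℝ → ℝ := fun x => if (2 : ℝ) ^ q < x ^ 2 then 0 else x with hlo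
  set hi : ℝ → ℝ := fun x => if (2 : ℝ) ^ q < x ^ 2 then x else 0 with hhi
  have hset : MeasurableSet {x : ℝ | (2 : ℝ) ^ q < x ^ 2} :=
    measurableSet_lt measurable_const (by fun_prop)
  have hlom : Measurable lo := Measurable.ite hset measurable_const measurable_id
  have hhim : Measurable hi := Measurable.ite hset measurable_id measurable_const
  have hadd : ∀ x, lo x + hi x = x := fun x => by
    simp only [hlo, hhi]; split_ifs <;> simp
  have hloabs : ∀ x, |lo x| ≤ √(2 ^ q) := fun x => by
    simp only [hlo]
    split_ifs with h
    · simp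
    · exact Real.abs_le_sqrt (not_lt.1 h)
  have hlosq : ∀ x, lo x ^ 2 ≤ x ^ 2 := fun x => by
    simp only [hlo]; split_ifs <;> nlinarith [sq_nonneg x]
  have hhisq : ∀ x, hi x ^ 2 = if (2 : ℝ) ^ q < x ^ 2 then x ^ 2 else 0 := fun x => by
    simp only [hhi]; split_ifs <;> simp
  have hhiabs : ∀ x, |hi x| ≤ |x| := fun x => by
    simp only [hhi]; split_ifs <;> simp
  have hloL : ∀ i, MemLp (fun ω => lo (y i ω)) 2 P := fun i =>
    MemLp.of_bound (hlom.comp (hy i)).aestronglyMeasurable _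
      (Filter.Eventually.of_forall fun ω => hloabs _)
  have hhiL : ∀ i, MemLp (fun ω => hi (y i ω)) 2 P := fun i =>
    (hL i).mono (hhim.comp (hy i)).aestronglyMeasurable
      (Filter.Eventually.of_forall fun ω => hhiabs _)
  have hint : ∀ {X : Ω → ℝ}, MemLp X 2 P → Integrable X P := fun h => h.integrable (by norm_num)
  set u : ℕ → Ω → ℝ := fun i ω => lo (y i ω) - ∫ ω', lo (y i ω') ∂P with hu
  set w : ℕ → Ω → ℝ := fun i ω => hi (y i ω) - ∫ ω', hi (y i ω') ∂P with hw
  have huw : ∀ i ω, y i ω = u i ω + w i ω := fun i ω => by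
    have h1 : ∫ ω', lo (y i ω') ∂P + ∫ ω', hi (y i ω') ∂P = 0 := by
      rw [← integral_add (hint (hloL i)) (hint (hhiL i))]
      simp_rw [hadd]
      exact hmean i
    simp only [hu, hw]
    linarith [hadd (y i ω)]
  have hum : ∀ i, Measurable (u i) := fun i => (hlom.comp (hy i)).sub_const _
  have hwm : ∀ i, Measurable (w i) := fun i => (hhim.comp (hy i)).sub_const _
  have huind : iIndepFun (fun i : Fin N => u i) P :=
    hind.comp (fun i x => lo x - ∫ ω', lo (y i ω') ∂P) fun i => hlom.sub_const _
  have hwind : iIndepFun (fun i : Fin N => w i) P :=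
    hind.comp (fun i x => hi x - ∫ ω', hi (y i ω') ∂P) fun i => hhim.sub_const _
  have humean : ∀ i, ∫ ω, u i ω ∂P = 0 := fun i => by
    simp only [hu]
    rw [integral_sub (hint (hloL i)) (integrable_const _)]
    simp
  have hwmean : ∀ i, ∫ ω, w i ω ∂P = 0 := fun i => by
    simp only [hw]
    rw [integral_sub (hint (hhiL i)) (integrable_const _)]
    simp
  have huc : ∀ i ω, |u i ω| ≤ 2 * √(2 ^ q) := fun i ω => by
    have h1 : |∫ ω', lo (y i ω') ∂P| ≤ √(2 ^ q) := by
      have := norm_integral_le_of_norm_le_const (μ := P) (f := fun ω' => lo (y i ω'))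
        (Filter.Eventually.of_forall fun ω' => hloabs (y i ω'))
      simpa using this
    refine (abs_sub _ _).trans ?_
    linarith [hloabs (y i ω)]
  have huv : ∀ i, ∫ ω, u i ω ^ 2 ∂P ≤ D := fun i =>
    ((integral_sub_mean_sq_le (hloL i)).trans
      (integral_mono (hloL i).integrable_sq (hL i).integrable_sq fun ω => hlosq _)).trans (hD i)
  have hwv : ∀ i, ∫ ω, w i ω ^ 2 ∂P ≤ δ q := fun i => by
    refine (integral_sub_mean_sq_le (hhiL i)).trans ?_
    simp_rw [hhisq]
    exact hδ i q
  have hwL : ∀ i, MemLp (w i) 2 P := fun i => (hhiL i).sub (memLp_const _)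
  obtain ⟨hI1, hE1⟩ := integral_max_sq_sub_le_of_bounded hD0 ht r hum huind huc humean huv hn hn'
  have hI2 := (memLp_maxAbsSum hwL n).integrable_sq
  have hE2 : ∫ ω, maxAbsSum (fun i => w i ω) n ^ 2 ∂P ≤ 8 * 2 ^ r * δ q := by
    refine (integral_maxAbsSum_sq_le hwm hwind hwL hwmean hn).trans ?_
    have h1 : ∑ i ∈ Finset.range n, ∫ ω, w i ω ^ 2 ∂P ≤ n * δ q :=
      (Finset.sum_le_sum fun i _ => hwv i).trans (by simp)
    have h2 : (n : ℝ) ≤ 2 ^ r * 2 := by exact_mod_cast hn'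
    have h3 : 0 ≤ δ q := (integral_nonneg fun ω => sq_nonneg (w 0 ω)).trans (hwv 0)
    nlinarith
  have hpt : ∀ ω, max (maxAbsSum (fun i => y i ω) n ^ 2 / 2 ^ r - 2 * (2 * D + 3) ^ 2 * t) 0 ≤
      2 * max (maxAbsSum (fun i => u i ω) n ^ 2 / 2 ^ r - (2 * D + 3) ^ 2 * t) 0 +
        2 / 2 ^ r * maxAbsSum (fun i => w i ω) n ^ 2 := fun ω => by
    have h1 : maxAbsSum (fun i => y i ω) n ≤
        maxAbsSum (fun i => u i ω) n + maxAbsSum (fun i => w i ω) n := by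
      simp_rw [huw]
      exact maxAbsSum_add_le _ _ n
    have h0 := maxAbsSum_nonneg (fun i => y i ω) n
    have h2 : maxAbsSum (fun i => y i ω) n ^ 2 ≤
        2 * maxAbsSum (fun i => u i ω) n ^ 2 + 2 * maxAbsSum (fun i => w i ω) n ^ 2 := by
      refine (pow_le_pow_left₀ h0 h1 2).trans ?_
      nlinarith [sq_nonneg (maxAbsSum (fun i => u i ω) n - maxAbsSum (fun i => w i ω) n)]
    have h3 : maxAbsSum (fun i => y i ω) n ^ 2 / 2 ^ r ≤
        2 * (maxAbsSum (fun i => u i ω) n ^ 2 / 2 ^ r) +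
          2 / 2 ^ r * maxAbsSum (fun i => w i ω) n ^ 2 := by
      refine (div_le_div_of_nonneg_right h2 (by positivity)).trans (le_of_eq ?_)
      ring
    refine max_le ?_ (by positivity)
    linarith [le_max_left (maxAbsSum (fun i => u i ω) n ^ 2 / 2 ^ r - (2 * D + 3) ^ 2 * t) 0]
  have hIy : Integrable (fun ω =>
      max (maxAbsSum (fun i => y i ω) n ^ 2 / 2 ^ r - 2 * (2 * D + 3) ^ 2 * t) 0) P := by
    have hM := measurable_maxAbsSum hy n
    refine ((hI1.const_mul 2).add (hI2.const_mul (2 / 2 ^ r))).mono'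
      ((((hM.pow_const 2).div_const _).sub_const _).max measurable_const).aestronglyMeasurable
      (Filter.Eventually.of_forall fun ω => ?_)
    rw [Real.norm_of_nonneg (le_max_right _ _)]
    exact hpt ω
  refine ⟨hIy, ?_⟩
  refine (integral_mono hIy ((hI1.const_mul 2).add (hI2.const_mul _)) hpt).trans ?_
  have e := integral_add (hI1.const_mul 2) (hI2.const_mul (2 / 2 ^ r))
  simp only [Pi.add_apply]
  rw [e, integral_const_mul, integral_const_mul]
  have h4 : 2 / 2 ^ r * ∫ ω, maxAbsSum (fun i => w i ω) n ^ 2 ∂P ≤ 16 * δ q := by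
    refine (mul_le_mul_of_nonneg_left hE2 (by positivity)).trans (le_of_eq ?_)
    field_simp
    ring
  linarith

lemma sum_range_half_le {g : ℕ → ℝ} (hg : ∀ q, 0 ≤ g q) (R : ℕ) :
    ∑ r ∈ Finset.range R, g (r / 2) ≤ 2 * ∑ q ∈ Finset.range R, g q := by
  have h : ∀ m, ∑ r ∈ Finset.range (2 * m), g (r / 2) = 2 * ∑ q ∈ Finset.range m, g q := by
    intro m
    induction m with
    | zero => simp
    | succ m ih =>
      rw [show 2 * (m + 1) = 2 * m + 1 + 1 by ring, Finset.sum_range_succ, Finset.sum_range_succ,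
        ih, Finset.sum_range_succ, show (2 * m + 1) / 2 = m by omega,
        show 2 * m / 2 = m by omega]
      ring
  rw [← h]
  exact Finset.sum_le_sum_of_subset_of_nonneg (Finset.range_subset_range.2 (by omega))
    fun _ _ _ => hg _

lemma exp_neg_sqrt_two_pow_le (q : ℕ) : Real.exp (-√(2 ^ q)) ≤ 2 * (1 / 2) ^ q := by
  have h := Real.quadratic_le_exp_of_nonneg (Real.sqrt_nonneg ((2 : ℝ) ^ q))
  rw [Real.sq_sqrt (by positivity)] at h
  have h1 : (2 : ℝ) ^ q / 2 ≤ Real.exp (√(2 ^ q)) := by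
    linarith [Real.sqrt_nonneg ((2 : ℝ) ^ q)]
  rw [Real.exp_neg, one_div, inv_pow, inv_le_comm₀ (Real.exp_pos _) (by positivity), mul_inv,
    inv_inv]
  linarith

/-- The expected block excess of a sequence of `N` independent centred variables. -/
lemma integral_blockExcess_le {D t : ℝ} {δ : ℕ → ℝ} (ht : 1 ≤ t)
    (hy : ∀ i, Measurable (y i)) (hind : iIndepFun (fun i : Fin N => y i) P)
    (hL : ∀ i, MemLp (y i) 2 P) (hmean : ∀ i, ∫ ω, y i ω ∂P = 0)
    (hD : ∀ i, ∫ ω, y i ω ^ 2 ∂P ≤ D)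
    (hδ : ∀ i q, ∫ ω, (if 2 ^ q < y i ω ^ 2 then y i ω ^ 2 else 0) ∂P ≤ δ q)
    (hδD : ∀ R, ∑ q ∈ Finset.range R, δ q ≤ D) :
    Integrable (fun ω => blockExcess (2 * (2 * D + 3) ^ 2 * t) (fun i => y i ω) N) P ∧
    ∫ ω, blockExcess (2 * (2 * D + 3) ^ 2 * t) (fun i => y i ω) N ∂P ≤
      1100 * (2 * D + 4) * ((Nat.log 2 N + 1 : ℕ) * Real.exp (-t) + 1) := by
  have hD0 : 0 ≤ D := (integral_nonneg fun ω => sq_nonneg (y 0 ω)).trans (hD 0)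
  have hδ0 : ∀ q, 0 ≤ δ q := fun q => by
    refine (integral_nonneg fun ω => ?_).trans (hδ 0 q)
    simp only [Pi.zero_apply]
    split_ifs
    · exact sq_nonneg _
    · exact le_rfl
  have h : ∀ r, _ := fun r => integral_max_sq_sub_le ht r hy hind hL hmean hD hδ
    (min_le_right (2 ^ (r + 1)) N) (min_le_left _ _)
  unfold blockExcess
  refine ⟨integrable_finsetSum _ fun r _ => (h r).1, ?_⟩
  rw [integral_finsetSum _ fun r _ => (h r).1]
  refine (Finset.sum_le_sum fun r _ => (h r).2).trans ?_
  set R := Nat.log 2 N + 1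
  rw [Finset.sum_add_distrib, ← Finset.mul_sum, Finset.sum_add_distrib, ← Finset.mul_sum,
    Finset.sum_const, Finset.card_range, nsmul_eq_mul]
  have h1 : ∑ r ∈ Finset.range R, δ (r / 2) ≤ 2 * D :=
    (sum_range_half_le hδ0 R).trans (by linarith [hδD R])
  have h2 : ∑ r ∈ Finset.range R, Real.exp (-√(2 ^ (r / 2))) ≤ 8 := by
    refine (sum_range_half_le (g := fun q => Real.exp (-√(2 ^ q)))
      (fun q => (Real.exp_pos _).le) R).trans ?_
    have h3 : ∑ q ∈ Finset.range R, Real.exp (-√(2 ^ q)) ≤ 4 := by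
      refine (Finset.sum_le_sum fun q _ => exp_neg_sqrt_two_pow_le q).trans ?_
      rw [← Finset.mul_sum]
      have := Summable.sum_le_tsum (Finset.range R) (fun q _ => by positivity)
        (summable_geometric_two)
      rw [tsum_geometric_two] at this
      linarith
    linarith
  have h4 : 0 ≤ (R : ℝ) * Real.exp (-t) := by positivity
  have h5 : 0 ≤ (2 * D + 4) * ((R : ℝ) * Real.exp (-t)) := by positivity
  have h6 : 128 * (2 * D + 4) * ((R : ℝ) * Real.exp (-t) +
      ∑ r ∈ Finset.range R, Real.exp (-√(2 ^ (r / 2)))) ≤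
      128 * (2 * D + 4) * ((R : ℝ) * Real.exp (-t) + 8) := by gcongr
  nlinarith

end Block

/-! ### Summable truncated second moments from the moment conditions. -/

section Moments

variable {Ω : Type*} [mΩ : MeasurableSpace Ω] {P : Measure Ω}

lemma integrable_and_integral_le_of_lintegral_le {f : Ω → ℝ} (hf : Measurable f)
    (hf0 : ∀ ω, 0 ≤ f ω) {c : ℝ} (hc : 0 ≤ c)
    (h : ∫⁻ ω, ENNReal.ofReal (f ω) ∂P ≤ ENNReal.ofReal c) :
    Integrable f P ∧ ∫ ω, f ω ∂P ≤ c := by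
  constructor
  · refine ⟨hf.aestronglyMeasurable, ?_⟩
    rw [hasFiniteIntegral_iff_ofReal (Filter.Eventually.of_forall hf0)]
    exact h.trans_lt ENNReal.ofReal_lt_top
  · rw [integral_eq_lintegral_of_nonneg_ae (Filter.Eventually.of_forall hf0)
      hf.aestronglyMeasurable]
    exact ENNReal.toReal_le_of_le_ofReal hc h

/-- At most `log₂ x + 1` levels `2^q` lie below `x > 1`. This is where the logarithm in the second
moment condition is needed. -/
lemma sum_indicator_two_pow_lt_le {x : ℝ} (hx : 0 ≤ x) (R : ℕ) :
    ∑ q ∈ Finset.range R, (if (2 : ℝ) ^ q < x then x else 0) ≤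
      3 * (x * Real.log (Real.exp 1 + x)) := by
  have hlog1 : 1 ≤ Real.log (Real.exp 1 + x) := by
    rw [Real.le_log_iff_exp_le (by positivity)]
    linarith
  rw [← Finset.sum_filter, Finset.sum_const, nsmul_eq_mul]
  have hcard : (((Finset.range R).filter fun q => (2 : ℝ) ^ q < x).card : ℝ) ≤
      3 * Real.log (Real.exp 1 + x) := by
    rcases le_or_gt x 1 with h1 | h1
    · rw [Finset.filter_false_of_mem]
      · simp; linarith
      · intro q _
        exact not_lt.2 (h1.trans (one_le_pow₀ (by norm_num)))
    · have hsub : ((Finset.range R).filter fun q => (2 : ℝ) ^ q < x) ⊆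
          Finset.range (⌊Real.logb 2 x⌋₊ + 1) := by
        intro q hq
        have hq := (Finset.mem_filter.1 hq).2
        rw [Finset.mem_range, Nat.lt_succ_iff]
        refine Nat.le_floor ?_
        rw [Real.le_logb_iff_rpow_le (by norm_num) (by linarith), Real.rpow_natCast]
        exact hq.le
      have h2 : ((⌊Real.logb 2 x⌋₊ + 1 : ℕ) : ℝ) ≤ Real.logb 2 x + 1 := by
        push_cast
        linarith [Nat.floor_le (Real.logb_nonneg (by norm_num : (1 : ℝ) < 2) h1.le)]
      have h3 : (((Finset.range R).filter fun q => (2 : ℝ) ^ q < x).card : ℝ) ≤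
          ((⌊Real.logb 2 x⌋₊ + 1 : ℕ) : ℝ) := by
        exact_mod_cast (Finset.card_le_card hsub).trans (by simp)
      have h4 : Real.logb 2 x ≤ 2 * Real.log (Real.exp 1 + x) := by
        rw [Real.logb, div_le_iff₀ (Real.log_pos (by norm_num))]
        have h5 : Real.log x ≤ Real.log (Real.exp 1 + x) :=
          Real.log_le_log (by linarith) (by linarith [Real.exp_pos 1])
        nlinarith [Real.log_two_gt_d9]
      linarith
  calc _ ≤ 3 * Real.log (Real.exp 1 + x) * x := by gcongr
    _ = _ := by ring

/-- Where `Y² > 2^q`, one has `Y² ≤ 2^(-qε/2) |Y|^(2+ε)`, so a geometric sequence bounds the tails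
for all indices at once. -/
lemma exists_tail_bound_of_moment_rpow [IsProbabilityMeasure P] {ι : Type*} {Y : ι → Ω → ℝ}
    (hY : ∀ i, Measurable (Y i)) {ε C₁ : ℝ} (hε : 0 < ε) (hC₁ : 0 < C₁)
    (h : ∀ i, ∫⁻ ω, ENNReal.ofReal (|Y i ω| ^ (2 + ε)) ∂P ≤ ENNReal.ofReal C₁) :
    ∃ δ : ℕ → ℝ, (∀ q, 0 ≤ δ q) ∧ (∀ R, ∑ q ∈ Finset.range R, δ q ≤ C₁ / (1 - 2 ^ (-(ε / 2)))) ∧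
      (∀ i, MemLp (Y i) 2 P) ∧ (∀ i, ∫ ω, Y i ω ^ 2 ∂P ≤ 1 + C₁) ∧
      ∀ i q, ∫ ω, (if 2 ^ q < Y i ω ^ 2 then Y i ω ^ 2 else 0) ∂P ≤ δ q := by
  set x : ℝ := 2 ^ (-(ε / 2)) with hx
  have hx0 : 0 < x := Real.rpow_pos_of_pos (by norm_num) _
  have hx1 : x < 1 := Real.rpow_lt_one_of_one_lt_of_neg (by norm_num) (by linarith)
  have hI : ∀ i, Integrable (fun ω => |Y i ω| ^ (2 + ε)) P ∧
      ∫ ω, |Y i ω| ^ (2 + ε) ∂P ≤ C₁ := fun i =>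
    integrable_and_integral_le_of_lintegral_le ((hY i).norm.pow_const _)
      (fun ω => Real.rpow_nonneg (abs_nonneg _) _) hC₁.le (h i)
  have hrpow : ∀ a : ℝ, 1 < a ^ 2 → |a| ^ (2 + ε) = a ^ 2 * (a ^ 2) ^ (ε / 2) := fun a ha => by
    have h0 : 0 < |a| := abs_pos.2 fun h => by rw [h] at ha; norm_num at ha
    rw [Real.rpow_add h0, Real.rpow_two, ← sq_abs a, ← Real.rpow_natCast (|a|) 2,
      ← Real.rpow_mul (abs_nonneg _)]
    congr 2
    push_cast; ring
  have hsq : ∀ a : ℝ, a ^ 2 ≤ 1 + |a| ^ (2 + ε) := fun a => by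
    have h0 : 0 ≤ |a| ^ (2 + ε) := Real.rpow_nonneg (abs_nonneg _) _
    rcases le_or_gt (a ^ 2) 1 with ha | ha
    · linarith
    · rw [hrpow a ha]
      have := Real.one_le_rpow ha.le (by linarith : 0 ≤ ε / 2)
      nlinarith
  have hsqI : ∀ i, Integrable (fun ω => Y i ω ^ 2) P := fun i =>
    ((integrable_const 1).add (hI i).1).mono' ((hY i).pow_const 2).aestronglyMeasurable
      (Filter.Eventually.of_forall fun ω => by
        rw [Real.norm_of_nonneg (sq_nonneg _)]
        exact hsq _)
  have htail : ∀ (a : ℝ) (q : ℕ), (if 2 ^ q < a ^ 2 then a ^ 2 else 0) ≤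
      x ^ q * |a| ^ (2 + ε) := fun a q => by
    have h0 : 0 ≤ |a| ^ (2 + ε) := Real.rpow_nonneg (abs_nonneg _) _
    split_ifs with ha
    · have h1 : 1 < a ^ 2 := (one_le_pow₀ (by norm_num)).trans_lt ha
      have h2 : ((2 : ℝ) ^ q) ^ (ε / 2) ≤ (a ^ 2) ^ (ε / 2) :=
        Real.rpow_le_rpow (by positivity) ha.le (by linarith)
      have h3 : x ^ q * ((2 : ℝ) ^ q) ^ (ε / 2) = 1 := by
        rw [hx, ← Real.rpow_natCast, ← Real.rpow_natCast, ← Real.rpow_mul (by norm_num),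
          ← Real.rpow_mul (by norm_num), ← Real.rpow_add (by norm_num)]
        ring_nf
        simp
      rw [hrpow a h1]
      calc a ^ 2 = a ^ 2 * (x ^ q * ((2 : ℝ) ^ q) ^ (ε / 2)) := by rw [h3, mul_one]
        _ ≤ a ^ 2 * (x ^ q * (a ^ 2) ^ (ε / 2)) := by gcongr
        _ = _ := by ring
    · positivity
  refine ⟨fun q => C₁ * x ^ q, fun q => by positivity, fun R => ?_, fun i => ?_, fun i => ?_,
    fun i q => ?_⟩
  · rw [← Finset.mul_sum, div_eq_mul_inv, ← tsum_geometric_of_lt_one hx0.le hx1]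
    exact mul_le_mul_of_nonneg_left (Summable.sum_le_tsum _ (fun q _ => by positivity)
      (summable_geometric_of_lt_one hx0.le hx1)) hC₁.le
  · exact (memLp_two_iff_integrable_sq (hY i).aestronglyMeasurable).2 (hsqI i)
  · refine (integral_mono (hsqI i) ((integrable_const 1).add (hI i).1) fun ω => hsq _).trans ?_
    have e := integral_add (integrable_const (μ := P) (1 : ℝ)) (hI i).1
    simp only [Pi.add_apply]
    rw [e]
    simpa using (hI i).2
  · refine (integral_mono_of_nonneg (Filter.Eventually.of_forall fun ω => ?_)
      ((hI i).1.const_mul (x ^ q)) (Filter.Eventually.of_forall fun ω => htail _ q)).trans ?_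
    · simp only [Pi.zero_apply]; split_ifs <;> positivity
    · rw [integral_const_mul, mul_comm]
      exact mul_le_mul_of_nonneg_right (hI i).2 (pow_nonneg hx0.le q)

/-- With a common law, the tails of one variable serve for all, and the sum over levels can be taken
inside a single expectation. -/
lemma exists_tail_bound_of_moment_log [IsProbabilityMeasure P] {ι : Type*} {Y : ι → Ω → ℝ}
    (i₀ : ι) (hY : ∀ i, Measurable (Y i)) {C₁ : ℝ} (hC₁ : 0 < C₁)
    (hid : ∀ i j, IdentDistrib (Y i) (Y j) P P)
    (h : ∀ i, ∫⁻ ω, ENNReal.ofReal (Y i ω ^ 2 * Real.log (Real.exp 1 + Y i ω ^ 2)) ∂P ≤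
      ENNReal.ofReal C₁) :
    ∃ δ : ℕ → ℝ, (∀ q, 0 ≤ δ q) ∧ (∀ R, ∑ q ∈ Finset.range R, δ q ≤ 3 * C₁) ∧
      (∀ i, MemLp (Y i) 2 P) ∧ (∀ i, ∫ ω, Y i ω ^ 2 ∂P ≤ C₁) ∧
      ∀ i q, ∫ ω, (if 2 ^ q < Y i ω ^ 2 then Y i ω ^ 2 else 0) ∂P ≤ δ q := by
  have hlog1 : ∀ a : ℝ, 1 ≤ Real.log (Real.exp 1 + a ^ 2) := fun a => by
    rw [Real.le_log_iff_exp_le (by positivity)]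
    linarith [sq_nonneg a]
  have hI : ∀ i, Integrable (fun ω => Y i ω ^ 2 * Real.log (Real.exp 1 + Y i ω ^ 2)) P ∧
      ∫ ω, Y i ω ^ 2 * Real.log (Real.exp 1 + Y i ω ^ 2) ∂P ≤ C₁ := fun i =>
    integrable_and_integral_le_of_lintegral_le
      (((hY i).pow_const 2).mul (((hY i).pow_const 2).const_add _).log)
      (fun ω => mul_nonneg (sq_nonneg _) (by linarith [hlog1 (Y i ω)])) hC₁.le (h i)
  have hsq : ∀ a : ℝ, a ^ 2 ≤ a ^ 2 * Real.log (Real.exp 1 + a ^ 2) := fun a =>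
    le_mul_of_one_le_right (sq_nonneg _) (hlog1 a)
  have hsqI : ∀ i, Integrable (fun ω => Y i ω ^ 2) P := fun i =>
    (hI i).1.mono' ((hY i).pow_const 2).aestronglyMeasurable
      (Filter.Eventually.of_forall fun ω => by
        rw [Real.norm_of_nonneg (sq_nonneg _)]
        exact hsq _)
  have hm : ∀ q : ℕ, Measurable fun a : ℝ => if (2 : ℝ) ^ q < a ^ 2 then a ^ 2 else 0 := fun q =>
    Measurable.ite (measurableSet_lt measurable_const (by fun_prop)) (by fun_prop)
      measurable_const
  have htI : ∀ q, Integrable (fun ω => if (2 : ℝ) ^ q < Y i₀ ω ^ 2 then Y i₀ ω ^ 2 else 0) P :=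
    fun q => (hsqI i₀).mono' ((hm q).comp (hY i₀)).aestronglyMeasurable
      (Filter.Eventually.of_forall fun ω => by
        split_ifs
        · rw [Real.norm_of_nonneg (sq_nonneg _)]
        · simpa using sq_nonneg (Y i₀ ω))
  refine ⟨fun q => ∫ ω, (if 2 ^ q < Y i₀ ω ^ 2 then Y i₀ ω ^ 2 else 0) ∂P, fun q => ?_,
    fun R => ?_, fun i => ?_, fun i => ?_, fun i q => le_of_eq ?_⟩
  · refine integral_nonneg fun ω => ?_
    simp only [Pi.zero_apply]; split_ifs <;> positivity
  · rw [← integral_finsetSum _ fun q _ => htI q]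
    refine (integral_mono (integrable_finsetSum _ fun q _ => htI q) ((hI i₀).1.const_mul 3)
      fun ω => sum_indicator_two_pow_lt_le (sq_nonneg _) R).trans ?_
    rw [integral_const_mul]
    linarith [(hI i₀).2]
  · exact (memLp_two_iff_integrable_sq (hY i).aestronglyMeasurable).2 (hsqI i)
  · exact (integral_mono (hsqI i) (hI i).1 fun ω => hsq _).trans (hI i).2
  · exact ((hid i i₀).comp (hm q)).integral_eq

/-- The moment condition bounds the variances and the tails of the normalized noise. -/
lemma MomentCondition.exists_tail_bound [IsProbabilityMeasure P] {n : ℕ} (hn : 1 ≤ n)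
    {Z : Fin n → Ω → ℝ} (hZ : ∀ i, Measurable (Z i)) {σ ε C₁ : ℝ} (hε : 0 < ε) (hC₁ : 0 < C₁)
    (h : MomentCondition P Z σ ε C₁) :
    ∃ δ : ℕ → ℝ, (∀ q, 0 ≤ δ q) ∧
      (∀ R, ∑ q ∈ Finset.range R, δ q ≤ 1 + 3 * C₁ + C₁ / (1 - 2 ^ (-(ε / 2)))) ∧
      (∀ i, MemLp (fun ω => Z i ω / σ) 2 P) ∧
      (∀ i, ∫ ω, (Z i ω / σ) ^ 2 ∂P ≤ 1 + 3 * C₁ + C₁ / (1 - 2 ^ (-(ε / 2)))) ∧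
      ∀ i q, ∫ ω, (if 2 ^ q < (Z i ω / σ) ^ 2 then (Z i ω / σ) ^ 2 else 0) ∂P ≤ δ q := by
  have hx1 : (2 : ℝ) ^ (-(ε / 2)) < 1 :=
    Real.rpow_lt_one_of_one_lt_of_neg (by norm_num) (by linarith)
  have hpos : 0 < C₁ / (1 - 2 ^ (-(ε / 2))) := div_pos hC₁ (by linarith)
  have hY : ∀ i, Measurable fun ω => Z i ω / σ := fun i => (hZ i).div_const σ
  rcases h with h | ⟨hid, h⟩
  · obtain ⟨δ, h0, h1, h2, h3, h4⟩ := exists_tail_bound_of_moment_rpow hY hε hC₁ h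
    exact ⟨δ, h0, fun R => (h1 R).trans (by linarith), h2, fun i => (h3 i).trans (by linarith), h4⟩
  · obtain ⟨δ, h0, h1, h2, h3, h4⟩ := exists_tail_bound_of_moment_log ⟨0, hn⟩ hY hC₁
      (fun i j => (hid i j).comp (measurable_id.div_const σ)) h
    exact ⟨δ, h0, fun R => (h1 R).trans (by linarith), h2, fun i => (h3 i).trans (by linarith), h4⟩

end Moments

/-! ### Expected excess over all pieces. -/

section Noise

variable {Ω : Type*} [mΩ : MeasurableSpace Ω] {P : Measure Ω} [IsProbabilityMeasure P]

lemma integral_pieceExcess_le {ζ : ℕ → Ω → ℝ} {n : ℕ} {D t : ℝ} {δ : ℕ → ℝ} (ht : 1 ≤ t)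
    (hζ : ∀ i, Measurable (ζ i)) (hind : iIndepFun (fun i : Fin n => ζ i) P)
    (hL : ∀ i, MemLp (ζ i) 2 P) (hmean : ∀ i, ∫ ω, ζ i ω ∂P = 0)
    (hD : ∀ i, ∫ ω, ζ i ω ^ 2 ∂P ≤ D)
    (hδ : ∀ i q, ∫ ω, (if 2 ^ q < ζ i ω ^ 2 then ζ i ω ^ 2 else 0) ∂P ≤ δ q)
    (hδD : ∀ R, ∑ q ∈ Finset.range R, δ q ≤ D) {a : ℕ → ℕ} (ha : Monotone a) {k : ℕ}
    (hk : a k = n) :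
    Integrable (fun ω => pieceExcess (2 * (2 * D + 3) ^ 2 * t) a k fun i => ζ i ω) P ∧
    ∫ ω, pieceExcess (2 * (2 * D + 3) ^ 2 * t) a k (fun i => ζ i ω) ∂P ≤
      2200 * (2 * D + 4) * ((∑ j ∈ Finset.range k, (Nat.log 2 (a (j + 1) - a j) + 1) : ℕ) *
        Real.exp (-t) + k) := by
  -- An injective reindexing keeps independence, so one bound covers both reading directions of each
  -- piece.
  have main : ∀ (N : ℕ) (e : ℕ → ℕ), (∀ d < N, e d < n) →
      (∀ d < N, ∀ d' < N, e d = e d' → d = d') → _ := fun N e he hinj =>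
    integral_blockExcess_le (y := fun d => ζ (e d)) (N := N) ht (fun d => hζ (e d))
      (hind.precomp (g := fun d : Fin N => (⟨e d, he d d.2⟩ : Fin n)) fun d d' h =>
        Fin.ext (hinj d d.2 d' d'.2 (by simpa using h)))
      (fun d => hL _) (fun d => hmean _) (fun d => hD _) (fun d q => hδ _ q) hδD
  have hb : ∀ j ∈ Finset.range k, a j ≤ a (j + 1) ∧ a (j + 1) ≤ n := fun j hj =>
    ⟨ha (Nat.le_succ j), hk ▸ ha (Finset.mem_range.1 hj)⟩
  have h1 : ∀ j ∈ Finset.range k, _ := fun j hj =>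
    main (a (j + 1) - a j) (fun d => a j + d) (fun d hd => by have := hb j hj; omega)
      (fun d _ d' _ h => by omega)
  have h2 : ∀ j ∈ Finset.range k, _ := fun j hj =>
    main (a (j + 1) - a j) (fun d => a j + (a (j + 1) - a j - 1 - d))
      (fun d hd => by have := hb j hj; omega) (fun d _ d' _ h => by omega)
  unfold pieceExcess
  have hI : ∀ j ∈ Finset.range k, Integrable (fun ω =>
      blockExcess (2 * (2 * D + 3) ^ 2 * t) (fun d => ζ (a j + d) ω) (a (j + 1) - a j) +
      blockExcess (2 * (2 * D + 3) ^ 2 * t)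
        (fun d => ζ (a j + (a (j + 1) - a j - 1 - d)) ω) (a (j + 1) - a j)) P := fun j hj =>
    (h1 j hj).1.add (h2 j hj).1
  refine ⟨integrable_finsetSum _ hI, ?_⟩
  rw [integral_finsetSum _ hI]
  calc _ ≤ ∑ j ∈ Finset.range k, 2200 * (2 * D + 4) *
        (((Nat.log 2 (a (j + 1) - a j) + 1 : ℕ) : ℝ) * Real.exp (-t) + 1) := by
        refine Finset.sum_le_sum fun j hj => ?_
        have e := integral_add (h1 j hj).1 (h2 j hj).1
        rw [e]
        linarith [(h1 j hj).2, (h2 j hj).2]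
    _ = _ := by
        rw [← Finset.mul_sum, Finset.sum_add_distrib, ← Finset.sum_mul, Nat.cast_sum]
        simp

end Noise

/-! ### Iterated logarithms and the number of blocks. -/

section Numeric

lemma one_lt_log_sixteen : 2.7182818286 < Real.log 16 := by
  rw [show (16 : ℝ) = 2 ^ 4 by norm_num, Real.log_pow]
  push_cast
  linarith [Real.log_two_gt_d9]

lemma log_sixteen_le_log {x : ℝ} (hx : 1 ≤ x) : 2.7182818286 < Real.log (16 * x) :=
  one_lt_log_sixteen.trans_le (Real.log_le_log (by norm_num) (by linarith))

/-- The constant `16` is chosen so that `log 16 > e`. -/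
lemma one_le_loglog {x : ℝ} (hx : 1 ≤ x) : 1 ≤ Real.log (Real.log (16 * x)) := by
  have h := log_sixteen_le_log hx
  rw [Real.le_log_iff_exp_le (by linarith)]
  linarith [Real.exp_one_lt_d9]

/-- If `1 ≤ y ≤ x`, the iterated logarithm at `x` is comparable to the one at `y`, up to the
factor by which the number of blocks at `x` is smaller than the number of pieces at `y`. -/
lemma loglog_mul_min_le {x y : ℝ} (hy : 1 ≤ y) (hx : 1 ≤ x) :
    Real.log (Real.log (16 * x)) * min 3 (2 * (y / x) * Real.log (16 * x)) ≤
      128 * Real.log (Real.log (16 * y)) := by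
  have hlx := log_sixteen_le_log hx
  have hly := log_sixteen_le_log hy
  have htx := one_le_loglog hx
  have hty := one_le_loglog hy
  -- If `x ≤ y²`, the iterated logarithms differ by at most a factor `2`. Otherwise `y / x ≤ 1 / √x`
  -- beats both logarithms, each being at most `4 (16 x)^(1/4)`.
  rcases le_total x (y ^ 2) with h | h
  · have h1 : Real.log (16 * x) ≤ 2 * Real.log (16 * y) := by
      rw [← Real.log_rpow (by positivity)]
      refine Real.log_le_log (by positivity) ?_
      norm_num
      nlinarith
    have h2 : Real.log (Real.log (16 * x)) ≤ Real.log 2 + Real.log (Real.log (16 * y)) := by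
      rw [← Real.log_mul (by norm_num) (by linarith)]
      exact Real.log_le_log (by linarith) h1
    have h3 : Real.log (Real.log (16 * x)) ≤ 2 * Real.log (Real.log (16 * y)) := by
      linarith [Real.log_two_lt_d9]
    calc _ ≤ Real.log (Real.log (16 * x)) * 3 := by gcongr; exact min_le_left _ _
      _ ≤ _ := by linarith
  · set w := (16 * x) ^ (1 / 4 : ℝ) with hw
    have hw0 : 0 < w := Real.rpow_pos_of_pos (by linarith) _
    have hw4 : w ^ 4 = 16 * x := by
      rw [hw, ← Real.rpow_natCast, ← Real.rpow_mul (by linarith)]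
      norm_num
    have h1 : Real.log (16 * x) ≤ 4 * w := by
      rw [← hw4, Real.log_pow]
      push_cast
      linarith [Real.log_le_sub_one_of_pos hw0]
    have h2 : Real.log (Real.log (16 * x)) ≤ Real.log (16 * x) := by
      linarith [Real.log_le_sub_one_of_pos (show 0 < Real.log (16 * x) by linarith)]
    have h3 : y ≤ w ^ 2 / 4 := by
      refine (Real.le_sqrt_of_sq_le h).trans (le_of_eq ?_)
      rw [show x = (w ^ 2 / 4) ^ 2 by rw [div_pow, ← pow_mul, hw4]; ring]
      exact Real.sqrt_sq (by positivity)
    calc _ ≤ Real.log (Real.log (16 * x)) * (2 * (y / x) * Real.log (16 * x)) := by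
          gcongr; exact min_le_right _ _
      _ ≤ (4 * w) * (2 * (y / x) * (4 * w)) := by
          have : 0 ≤ Real.log (16 * x) := by linarith
          gcongr
          exact h2.trans h1
      _ = 32 * w ^ 2 * y / x := by ring
      _ ≤ 32 * w ^ 2 * (w ^ 2 / 4) / x := by gcongr
      _ = 128 := by
          rw [show 32 * w ^ 2 * (w ^ 2 / 4) = 8 * w ^ 4 by ring, hw4]
          field_simp
          norm_num
      _ ≤ _ := by linarith

lemma sum_log_pieces_le {a : ℕ → ℕ} (ha : Monotone a) {k n : ℕ} (h0 : a 0 = 0) (hk : a k = n)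
    (hk1 : 1 ≤ k) (hkn : k ≤ n) :
    ((∑ j ∈ Finset.range k, (Nat.log 2 (a (j + 1) - a j) + 1) : ℕ) : ℝ) ≤
      2 * k * Real.log (16 * (n / k)) := by
  have hk0 : (0 : ℝ) < k := by exact_mod_cast hk1
  have hn0 : (0 : ℝ) < n := by exact_mod_cast hk1.trans hkn
  have hx : (1 : ℝ) ≤ n / k := by rw [one_le_div hk0]; exact_mod_cast hkn
  have hl0 : 0 ≤ Real.log (n / k) := Real.log_nonneg hx
  -- The tangent of the logarithm at the mean length `n / k`; its linear terms add up to `k` over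
  -- the pieces. Empty pieces are harmless because `Nat.log 2 0 = 0`.
  have hterm : ∀ N : ℕ, ((Nat.log 2 N : ℕ) : ℝ) * Real.log 2 ≤
      Real.log (n / k) + N * (k / n) := fun N => by
    rcases Nat.eq_zero_or_pos N with rfl | hN
    · simpa using hl0
    · have hN0 : (0 : ℝ) < N := by exact_mod_cast hN
      have h1 : ((Nat.log 2 N : ℕ) : ℝ) * Real.log 2 ≤ Real.log N := by
        rw [← Real.log_pow]
        refine Real.log_le_log (by positivity) ?_
        exact_mod_cast Nat.pow_log_le_self 2 hN.ne'
      have h2 : Real.log N = Real.log (n / k) + Real.log (N * (k / n)) := by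
        rw [← Real.log_mul (by positivity) (by positivity)]
        congr 1
        field_simp
      have h3 := Real.log_le_sub_one_of_pos (show 0 < (N : ℝ) * (k / n) by positivity)
      linarith
  have hsum : ∑ j ∈ Finset.range k, ((a (j + 1) - a j : ℕ) : ℝ) = n := by
    rw [← Nat.cast_sum]
    have := sum_pieces_eq_sum_Ico ha (fun _ => 1) k
    simp only [Finset.sum_const, Finset.card_range, smul_eq_mul, mul_one, Nat.card_Ico] at this
    rw [this, h0, hk, Nat.sub_zero]
  have h1 : ((∑ j ∈ Finset.range k, (Nat.log 2 (a (j + 1) - a j) + 1) : ℕ) : ℝ) * Real.log 2 ≤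
      k * (Real.log (n / k) + 1 + Real.log 2) := by
    push_cast
    rw [Finset.sum_mul]
    calc _ ≤ ∑ j ∈ Finset.range k, (Real.log (n / k) + ((a (j + 1) - a j : ℕ) : ℝ) * (k / n)
          + Real.log 2) := Finset.sum_le_sum fun j _ => by
            have := hterm (a (j + 1) - a j)
            linarith
      _ = _ := by
          rw [Finset.sum_add_distrib, Finset.sum_add_distrib, ← Finset.sum_mul, hsum]
          simp only [Finset.sum_const, Finset.card_range, nsmul_eq_mul]
          field_simp
  have h2 : Real.log (16 * (n / k)) = 4 * Real.log 2 + Real.log (n / k) := by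
    rw [Real.log_mul (by norm_num) (by positivity), show (16 : ℝ) = 2 ^ 4 by norm_num,
      Real.log_pow]
    push_cast; ring
  rw [h2]
  have h3 := Real.log_two_gt_d9
  have h4 : (k : ℝ) * (Real.log (n / k) + 1 + Real.log 2) ≤
      2 * k * (4 * Real.log 2 + Real.log (n / k)) * Real.log 2 := by
    have : Real.log (n / k) + 1 + Real.log 2 ≤
        2 * (4 * Real.log 2 + Real.log (n / k)) * Real.log 2 := by nlinarith
    nlinarith
  exact le_of_mul_le_mul_right (h1.trans h4) (by linarith)

end Numeric

/-! ### Structure of the piecewise constant vectors. -/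

section Pieces

/-- A description of the members of `Theta n k` by functions on the natural numbers. -/
lemma exists_pieces_of_mem_Theta {n k : ℕ} {θ : EuclideanSpace ℝ (Fin n)} (h : θ ∈ Theta n k) :
    ∃ (a : ℕ → ℕ) (m : ℕ → ℝ), Monotone a ∧ a 0 = 0 ∧ a k = n ∧
      (∀ j j', j ≤ j' → j' < k → m j ≤ m j') ∧
      ∀ j < k, ∀ i : Fin n, a j ≤ i → (i : ℕ) < a (j + 1) → θ i = m j := by
  obtain ⟨a, m, h0, hk, ha, hm, hθ⟩ := h
  refine ⟨fun j => a ⟨min j k, by omega⟩, fun j => if h : j < k then m ⟨j, h⟩ else 0,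
    fun j j' h => ha ?_, ?_, ?_, fun j j' h h' => ?_, fun j hj i h1 h2 => ?_⟩
  · simp only [Fin.mk_le_mk]; omega
  · simpa using h0
  · simpa [Fin.last] using hk
  · beta_reduce
    rw [dif_pos h', dif_pos (h.trans_lt h')]
    exact hm h
  · beta_reduce
    rw [dif_pos hj]
    refine hθ ⟨j, hj⟩ i ?_ ?_
    · have e : (⟨min j k, by omega⟩ : Fin (k + 1)) = (⟨j, hj⟩ : Fin k).castSucc :=
        Fin.ext (by simp; omega)
      rw [← e]; exact Nat.lt_succ_of_le h1
    · have e : (⟨min (j + 1) k, by omega⟩ : Fin (k + 1)) = (⟨j, hj⟩ : Fin k).succ :=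
        Fin.ext (by simp; omega)
      rw [← e]; exact h2

lemma exists_piece_of_lt {a : ℕ → ℕ} (h0 : a 0 = 0) {k i : ℕ} (hi : i < a k) :
    ∃ j < k, a j ≤ i ∧ i < a (j + 1) := by
  induction k with
  | zero => omega
  | succ k ih =>
    rcases lt_or_ge i (a k) with h | h
    · obtain ⟨j, hj, hj'⟩ := ih h
      exact ⟨j, by omega, hj'⟩
    · exact ⟨k, by omega, h, hi⟩

lemma monotone_of_mem_Theta {n k : ℕ} {θ : EuclideanSpace ℝ (Fin n)} (h : θ ∈ Theta n k)
    {i i' : Fin n} (hii : i ≤ i') : θ i ≤ θ i' := by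
  obtain ⟨a, m, ha, h0, hk, hm, hθ⟩ := exists_pieces_of_mem_Theta h
  obtain ⟨j, hj, h1, h2⟩ := exists_piece_of_lt h0 (hk.symm ▸ i.2 : (i : ℕ) < a k)
  obtain ⟨j', hj', h1', h2'⟩ := exists_piece_of_lt h0 (hk.symm ▸ i'.2 : (i' : ℕ) < a k)
  rw [hθ j hj i h1 h2, hθ j' hj' i' h1' h2']
  refine hm j j' ?_ hj'
  by_contra hlt
  have := ha (show j' + 1 ≤ j by omega)
  have : (i : ℕ) ≤ i' := hii
  omega

lemma exists_jumps_of_mem_Theta {n l : ℕ} {θ : EuclideanSpace ℝ (Fin n)} (h : θ ∈ Theta n l) :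
    ∃ B : Finset ℕ, B.card ≤ l + 1 ∧
      ∀ (i : ℕ) (hi : i + 1 < n), θ ⟨i + 1, hi⟩ ≠ θ ⟨i, by omega⟩ → i ∈ B := by
  obtain ⟨a, m, ha, h0, hk, hm, hθ⟩ := exists_pieces_of_mem_Theta h
  -- A jump between `i` and `i + 1` forces `i + 1` to be a breakpoint. The truncated value at `a 0 =
  -- 0` only enlarges the set.
  refine ⟨(Finset.range (l + 1)).image fun j => a j - 1,
    Finset.card_image_le.trans (by simp), fun i hi hne => ?_⟩
  obtain ⟨j, hj, h1, h2⟩ := exists_piece_of_lt h0 (by omega : i < a l)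
  by_cases hlt : i + 1 < a (j + 1)
  · exact absurd ((hθ j hj ⟨i + 1, hi⟩ (by simp; omega) hlt).trans
      (hθ j hj ⟨i, by omega⟩ h1 h2).symm) hne
  · exact Finset.mem_image.2 ⟨j + 1, Finset.mem_range.2 (by omega), by omega⟩

lemma zero_mem_Theta {n k : ℕ} (hk : 1 ≤ k) : (0 : EuclideanSpace ℝ (Fin n)) ∈ Theta n k := by
  refine ⟨fun j => if j = 0 then 0 else n, fun _ => 0, by simp, ?_, ?_, monotone_const, ?_⟩
  · refine if_neg fun h => ?_
    have := congrArg Fin.val h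
    simp at this
    omega
  · intro j j' h
    by_cases hj : j = 0
    · simp [hj]
    · have : j' ≠ 0 := fun h' => hj (Fin.le_zero_iff.1 (h' ▸ h))
      simp [hj, this]
  · simp

end Pieces

/-! ### Noise controlled by the penalties. -/

lemma pen_eq_mul_pen_one (τ : ℝ) (n k : ℕ) : pen τ n k = τ * pen 1 n k := by
  unfold pen
  split_ifs <;> ring

lemma pen_one_of_two_le {n k : ℕ} (hk : 2 ≤ k) :
    pen 1 n k = k * Real.log (Real.log (16 * (n / k))) := by
  unfold pen
  rw [if_neg (by omega), one_mul, mul_div_assoc]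

lemma one_le_div_cast {n k : ℕ} (hk : 1 ≤ k) (hkn : k ≤ n) : (1 : ℝ) ≤ n / k := by
  rw [one_le_div (by exact_mod_cast hk)]
  exact_mod_cast hkn

lemma le_pen_one {n k : ℕ} (hk : 1 ≤ k) (hkn : k ≤ n) : (k : ℝ) ≤ pen 1 n k := by
  rcases Nat.eq_or_lt_of_le hk with rfl | hk2
  · simp [pen]
  · rw [pen_one_of_two_le hk2]
    exact le_mul_of_one_le_right (Nat.cast_nonneg k) (one_le_loglog (one_le_div_cast hk hkn))

lemma loglog_mul_blocks_le_pen {n k l : ℕ} (hk : 1 ≤ k) (hkn : k ≤ n) (hl : 1 ≤ l) (hln : l ≤ n)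
    (hkl : ¬(k = 1 ∧ l = 1)) {M : ℝ} (hM1 : M ≤ 2 * k * Real.log (16 * (n / k)))
    (hM2 : M ≤ l + 1 + k) :
    Real.log (Real.log (16 * (n / k))) * M ≤ 128 * (pen 1 n k + pen 1 n l) := by
  have hx := one_le_div_cast hk hkn
  have hy := one_le_div_cast hl hln
  have htx := one_le_loglog hx
  have hk1 : (1 : ℝ) ≤ k := by exact_mod_cast hk
  have hl1 : (1 : ℝ) ≤ l := by exact_mod_cast hl
  have hn0 : (0 : ℝ) < n := by exact_mod_cast hk.trans hkn
  have hpk := le_pen_one hk hkn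
  have hpl := le_pen_one hl hln
  -- If `l ≤ k`, then `k ≥ 2` and `M ≤ 3 k`, so the penalty of `k` suffices. If `l > k`, then `l ≥
  -- 2`, and both bounds on `M` are needed to pay with the iterated logarithm at `n / l`.
  rcases le_or_gt l k with h | h
  · have hlk : (l : ℝ) ≤ k := by exact_mod_cast h
    have e := pen_one_of_two_le (n := n) (show 2 ≤ k by omega)
    have : Real.log (Real.log (16 * (n / k))) * M ≤
        Real.log (Real.log (16 * (n / k))) * (3 * k) := by gcongr; linarith
    linarith
  · have hlk : (k : ℝ) ≤ l := by exact_mod_cast h.le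
    have e := pen_one_of_two_le (n := n) (show 2 ≤ l by omega)
    have h1 := loglog_mul_min_le hy hx
    have h2 : M ≤ l * min 3 (2 * ((n / l : ℝ) / (n / k)) * Real.log (16 * (n / k))) := by
      rw [mul_min_of_nonneg _ _ (by linarith : (0 : ℝ) ≤ l)]
      refine le_min (by linarith) (hM1.trans (le_of_eq ?_))
      field_simp
    calc _ ≤ Real.log (Real.log (16 * (n / k))) *
          (l * min 3 (2 * ((n / l : ℝ) / (n / k)) * Real.log (16 * (n / k)))) := by gcongr
      _ = l * (Real.log (Real.log (16 * (n / k))) *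
          min 3 (2 * ((n / l : ℝ) / (n / k)) * Real.log (16 * (n / k)))) := by ring
      _ ≤ l * (128 * Real.log (Real.log (16 * (n / l)))) := by gcongr
      _ = 128 * pen 1 n l := by rw [e]; ring
      _ ≤ _ := by linarith

/-- A bound for the noise in the direction of the difference of a member of `Theta n l` and a
member of `Theta n k`, by the excess over the pieces of the latter. -/
lemma sq_sum_mul_sub_le {n k : ℕ} (hk : 1 ≤ k) (hkn : k ≤ n) {θ : EuclideanSpace ℝ (Fin n)}
    {a : ℕ → ℕ} {m : ℕ → ℝ} (ha : Monotone a) (h0 : a 0 = 0) (hak : a k = n)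
    (hθ : ∀ j < k, ∀ i : Fin n, a j ≤ i → (i : ℕ) < a (j + 1) → θ i = m j)
    {l : ℕ} (hl : 1 ≤ l) (hln : l ≤ n) {θ' : EuclideanSpace ℝ (Fin n)} (hθ' : θ' ∈ Theta n l)
    (z : ℕ → ℝ) {D : ℝ} :
    (∑ i : Fin n, z i * (θ' i - θ i)) ^ 2 ≤ ‖θ' - θ‖ ^ 2 *
      (2 * pieceExcess (2 * (2 * D + 3) ^ 2 * Real.log (Real.log (16 * (n / k)))) a k z +
        maxAbsSum z n ^ 2 / n +
        1024 * (2 * D + 3) ^ 2 * (pen 1 n k + pen 1 n l)) := by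
  set t := Real.log (Real.log (16 * (n / k))) with ht
  have ht1 : 1 ≤ t := one_le_loglog (one_le_div_cast hk hkn)
  have hn0 : (0 : ℝ) < n := by exact_mod_cast hk.trans hkn
  have hpe : ∀ T, 0 ≤ pieceExcess T a k z := fun T => Finset.sum_nonneg fun j _ =>
    add_nonneg (blockExcess_nonneg _ _ _) (blockExcess_nonneg _ _ _)
  have hpk := le_pen_one hk hkn
  have hpl := le_pen_one hl hln
  have hpk0 : 0 ≤ pen 1 n k := (Nat.cast_nonneg k).trans hpk
  have hpl0 : 0 ≤ pen 1 n l := (Nat.cast_nonneg l).trans hpl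
  set v : ℕ → ℝ := fun i => if h : i < n then θ' ⟨i, h⟩ - θ ⟨i, h⟩ else 0 with hv
  have hvi : ∀ (i : ℕ) (h : i < n), v i = θ' ⟨i, h⟩ - θ ⟨i, h⟩ := fun i h => dif_pos h
  have e1 : ∑ i : Fin n, z i * (θ' i - θ i) = ∑ i ∈ Finset.range n, z i * v i := by
    rw [Finset.sum_range]
    exact Finset.sum_congr rfl fun i _ => by rw [hvi i i.2]
  have e2 : ‖θ' - θ‖ ^ 2 = ∑ i ∈ Finset.range n, v i ^ 2 := by
    rw [EuclideanSpace.norm_sq_eq, Finset.sum_range]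
    exact Finset.sum_congr rfl fun i _ => by rw [hvi i i.2, Real.norm_eq_abs, sq_abs]; rfl
  have han : ∀ j < k, a (j + 1) ≤ n := fun j hj => hak ▸ ha hj
  rw [e1, e2]
  -- The only pair for which neither penalty contains an iterated logarithm: the difference is
  -- constant, and the squared total noise over `n` suffices.
  by_cases hkl : k = 1 ∧ l = 1
  · obtain ⟨rfl, rfl⟩ := hkl
    obtain ⟨a', m', -, h0', hak', -, hθc'⟩ := exists_pieces_of_mem_Theta hθ'
    have hconst : ∀ i ∈ Finset.range n, v i = m' 0 - m 0 := fun i hi => by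
      have hi := Finset.mem_range.1 hi
      rw [hvi i hi, hθ 0 one_pos ⟨i, hi⟩ (by simp [h0]) (by rw [zero_add, hak]; exact hi),
        hθc' 0 one_pos ⟨i, hi⟩ (by simp [h0']) (by rw [zero_add, hak']; exact hi)]
    have e3 : ∑ i ∈ Finset.range n, z i * v i = (∑ i ∈ Finset.range n, z i) * (m' 0 - m 0) := by
      rw [Finset.sum_mul]
      exact Finset.sum_congr rfl fun i hi => by rw [hconst i hi]
    have e4 : ∑ i ∈ Finset.range n, v i ^ 2 = n * (m' 0 - m 0) ^ 2 := by
      rw [Finset.sum_congr rfl fun i hi => congrArg (· ^ 2) (hconst i hi)]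
      simp
    rw [e3, e4, mul_pow]
    have h1 : (∑ i ∈ Finset.range n, z i) ^ 2 ≤ maxAbsSum z n ^ 2 := by
      rw [← sq_abs]
      exact pow_le_pow_left₀ (abs_nonneg _) (abs_sum_le_maxAbsSum z le_rfl) 2
    calc _ ≤ maxAbsSum z n ^ 2 * (m' 0 - m 0) ^ 2 := by gcongr
      _ = n * (m' 0 - m 0) ^ 2 * (maxAbsSum z n ^ 2 / n) := by field_simp
      _ ≤ _ := by
          refine mul_le_mul_of_nonneg_left ?_ (by positivity)
          have := hpe (2 * (2 * D + 3) ^ 2 * t)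
          have : 0 ≤ 1024 * (2 * D + 3) ^ 2 * (pen 1 n 1 + pen 1 n 1) := by positivity
          linarith
  · obtain ⟨B, hBcard, hB⟩ := exists_jumps_of_mem_Theta hθ'
    have hmain := sq_sum_mul_le_pieceExcess (T := 2 * (2 * D + 3) ^ 2 * t) (by positivity) ha h0
      hak z (v := v) (B := B) ?_ ?_
    · refine hmain.trans (mul_le_mul_of_nonneg_left ?_ (Finset.sum_nonneg fun _ _ => sq_nonneg _))
      set M := min (∑ j ∈ Finset.range k, (Nat.log 2 (a (j + 1) - a j) + 1)) (B.card + k) with hM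
      have hM1 : (M : ℝ) ≤ 2 * k * Real.log (16 * (n / k)) :=
        le_trans (by exact_mod_cast min_le_left _ _) (sum_log_pieces_le ha h0 hak hk hkn)
      have hM2 : (M : ℝ) ≤ l + 1 + k := by
        have : M ≤ l + 1 + k := (min_le_right _ _).trans (by omega)
        exact_mod_cast this
      have h1 := loglog_mul_blocks_le_pen hk hkn hl hln hkl hM1 hM2
      have h2 : 8 * (2 * D + 3) ^ 2 * (t * M) ≤
          8 * (2 * D + 3) ^ 2 * (128 * (pen 1 n k + pen 1 n l)) := by gcongr
      have h3 : 0 ≤ maxAbsSum z n ^ 2 / n := by positivity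
      linarith
    · intro j hj i i' h1 h2 h3
      have hi' : i' < n := h3.trans_le (han j hj)
      rw [hvi i (h2.trans_lt hi'), hvi i' hi',
        hθ j hj ⟨i, h2.trans_lt hi'⟩ h1 (h2.trans_lt h3), hθ j hj ⟨i', hi'⟩ (h1.trans h2) h3]
      exact sub_le_sub_right (monotone_of_mem_Theta hθ' h2) _
    · intro j hj i h1 h2 hne
      have hi' : i + 1 < n := h2.trans_le (han j hj)
      refine hB i hi' fun h => hne ?_
      rw [hvi i (by omega), hvi (i + 1) hi', h,
        hθ j hj ⟨i, by omega⟩ h1 (by simp; omega), hθ j hj ⟨i + 1, hi'⟩ (by simp; omega) h2]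

/-! ### From the noise bound to the risk. -/

section Risk

variable {Ω : Type*} [mΩ : MeasurableSpace Ω] {P : Measure Ω} [IsProbabilityMeasure P]

/-- The noise is controlled by an integrable variable of mean `O(k)` and by the penalties. -/
lemma exists_noise_bound {n k : ℕ} (hk : 1 ≤ k) (hkn : k ≤ n) {θ : EuclideanSpace ℝ (Fin n)}
    (hθ : θ ∈ Theta n k) {Z : Fin n → Ω → ℝ} (hZ : IsCenteredIndepNoise P Z) {σ D : ℝ}
    (hσ : 0 < σ) {δ : ℕ → ℝ} (hδ0 : ∀ q, 0 ≤ δ q) (hδD : ∀ R, ∑ q ∈ Finset.range R, δ q ≤ D)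
    (hL : ∀ i, MemLp (fun ω => Z i ω / σ) 2 P) (hD : ∀ i, ∫ ω, (Z i ω / σ) ^ 2 ∂P ≤ D)
    (hδ : ∀ i q, ∫ ω, (if 2 ^ q < (Z i ω / σ) ^ 2 then (Z i ω / σ) ^ 2 else 0) ∂P ≤ δ q) :
    ∃ F : Ω → ℝ, Integrable F P ∧ (∀ ω, 0 ≤ F ω) ∧
      ∫ ω, F ω ∂P ≤ (13200 * (2 * D + 4) + 4 * D) * k ∧
      ∀ ω, ∀ l, 1 ≤ l → l ≤ n → ∀ θ' ∈ Theta n l,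
        (∑ i, Z i ω * (θ' i - θ i)) ^ 2 ≤ ‖θ' - θ‖ ^ 2 *
          (σ ^ 2 * (F ω + 1024 * (2 * D + 3) ^ 2 * (pen 1 n k + pen 1 n l))) := by
  obtain ⟨a, m, ha, h0, hak, -, hθ⟩ := exists_pieces_of_mem_Theta hθ
  have hD0 : 0 ≤ D := (Finset.sum_nonneg fun q _ => hδ0 q).trans (hδD 0)
  set ζ : ℕ → Ω → ℝ := fun i ω => if h : i < n then Z ⟨i, h⟩ ω / σ else 0 with hζ
  have hζi : ∀ (i : ℕ) (h : i < n), ζ i = fun ω => Z ⟨i, h⟩ ω / σ := fun i h => by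
    funext ω; exact dif_pos h
  have hζ0 : ∀ (i : ℕ), ¬i < n → ζ i = fun _ => 0 := fun i h => by
    funext ω; exact dif_neg h
  have hmeas : ∀ i, Measurable (ζ i) := fun i => by
    by_cases h : i < n
    · rw [hζi i h]; exact (hZ.measurable _).div_const σ
    · rw [hζ0 i h]; exact measurable_const
  have hind : iIndepFun (fun i : Fin n => ζ i) P := by
    have h := hZ.indep.comp (fun _ x => x / σ) fun _ => measurable_id.div_const σ
    have e : (fun i : Fin n => ζ i) = fun i => (fun x => x / σ) ∘ Z i := by
      funext i; rw [hζi i i.2]; rfl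
    rw [e]; exact h
  have hζL : ∀ i, MemLp (ζ i) 2 P := fun i => by
    by_cases h : i < n
    · rw [hζi i h]; exact hL _
    · rw [hζ0 i h]; exact MemLp.zero'
  have hmean : ∀ i, ∫ ω, ζ i ω ∂P = 0 := fun i => by
    by_cases h : i < n
    · rw [hζi i h, integral_div, hZ.mean_zero, zero_div]
    · rw [hζ0 i h]; simp
  have hζD : ∀ i, ∫ ω, ζ i ω ^ 2 ∂P ≤ D := fun i => by
    by_cases h : i < n
    · rw [hζi i h]; exact hD _
    · rw [hζ0 i h]; simpa using hD0
  have hζδ : ∀ i q, ∫ ω, (if 2 ^ q < ζ i ω ^ 2 then ζ i ω ^ 2 else 0) ∂P ≤ δ q := fun i q => by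
    by_cases h : i < n
    · rw [hζi i h]; exact hδ _ q
    · rw [hζ0 i h]; simpa using hδ0 q
  set t := Real.log (Real.log (16 * (n / k))) with ht
  have hx := one_le_div_cast hk hkn
  have ht1 : 1 ≤ t := one_le_loglog hx
  obtain ⟨hI1, hE1⟩ := integral_pieceExcess_le ht1 hmeas hind hζL hmean hζD hζδ hδD ha hak
  have hI2 : Integrable (fun ω => maxAbsSum (fun i => ζ i ω) n ^ 2 / n) P :=
    (memLp_maxAbsSum hζL n).integrable_sq.div_const _
  have hn0 : (0 : ℝ) < n := by exact_mod_cast hk.trans hkn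
  have hk1 : (1 : ℝ) ≤ k := by exact_mod_cast hk
  have hE2 : ∫ ω, maxAbsSum (fun i => ζ i ω) n ^ 2 / n ∂P ≤ 4 * D := by
    rw [integral_div, div_le_iff₀ hn0]
    refine (integral_maxAbsSum_sq_le hmeas hind hζL hmean le_rfl).trans ?_
    have : ∑ i ∈ Finset.range n, ∫ ω, ζ i ω ^ 2 ∂P ≤ n * D :=
      (Finset.sum_le_sum fun i _ => hζD i).trans (by simp)
    linarith
  refine ⟨fun ω => 2 * pieceExcess (2 * (2 * D + 3) ^ 2 * t) a k (fun i => ζ i ω) +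
    maxAbsSum (fun i => ζ i ω) n ^ 2 / n, (hI1.const_mul 2).add hI2, fun ω => ?_, ?_, ?_⟩
  · refine add_nonneg (mul_nonneg zero_le_two (Finset.sum_nonneg fun j _ =>
      add_nonneg (blockExcess_nonneg _ _ _) (blockExcess_nonneg _ _ _))) (by positivity)
  · have e := integral_add (hI1.const_mul 2) hI2
    rw [e, integral_const_mul]
    -- The cancellation behind the iterated logarithm: `exp (-t)` compensates the number of blocks
    -- up to `2 k`. With `2 k + k = 3 k` and the factor `2` in `F`, `2200` becomes `13200`.
    have hΛ : Real.exp (-t) = (Real.log (16 * (n / k)))⁻¹ := by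
      rw [ht, Real.exp_neg, Real.exp_log (by linarith [log_sixteen_le_log hx])]
    have hΛ0 : 0 < Real.log (16 * (n / k)) := by linarith [log_sixteen_le_log hx]
    have h1 : ((∑ j ∈ Finset.range k, (Nat.log 2 (a (j + 1) - a j) + 1) : ℕ) : ℝ) *
        Real.exp (-t) ≤ 2 * k := by
      rw [hΛ, ← div_eq_mul_inv, div_le_iff₀ hΛ0]
      exact sum_log_pieces_le ha h0 hak hk hkn
    have h2 : 2200 * (2 * D + 4) *
        ((∑ j ∈ Finset.range k, (Nat.log 2 (a (j + 1) - a j) + 1) : ℕ) * Real.exp (-t) + k) ≤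
        2200 * (2 * D + 4) * (2 * k + k) := by gcongr
    have h3 : 4 * D ≤ 4 * D * k := le_mul_of_one_le_right (by positivity) hk1
    linarith
  · intro ω l hl hln θ' hθ'
    have h := sq_sum_mul_sub_le hk hkn ha h0 hak hθ hl hln hθ' (fun i => ζ i ω) (D := D)
    have e : ∑ i, Z i ω * (θ' i - θ i) = σ * ∑ i : Fin n, ζ i ω * (θ' i - θ i) := by
      rw [Finset.mul_sum]
      refine Finset.sum_congr rfl fun i _ => ?_
      rw [hζi i i.2]
      field_simp
    rw [e, mul_pow]
    calc _ ≤ σ ^ 2 * _ := mul_le_mul_of_nonneg_left h (sq_nonneg σ)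
      _ = _ := by ring

lemma sq_dist_le_of_penalized_le {n : ℕ} {θ θ' θstar z : EuclideanSpace ℝ (Fin n)} {S p p' : ℝ}
    (hS : 0 ≤ S)
    (hz : (∑ i, z i * (θ' i - θ i)) ^ 2 ≤ ‖θ' - θ‖ ^ 2 * S)
    (h : ‖θstar + z - θ'‖ ^ 2 + p' ≤ ‖θstar + z - θ‖ ^ 2 + p) :
    ‖θ' - θstar‖ ^ 2 ≤ 3 * ‖θ - θstar‖ ^ 2 + 8 * S + 2 * (p - p') := by
  set x := ∑ i, z i * (θ' i - θ i) with hx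
  have h1 : ‖θstar + z - θ‖ ^ 2 - ‖θstar + z - θ'‖ ^ 2 =
      ‖θ - θstar‖ ^ 2 - ‖θ' - θstar‖ ^ 2 + 2 * x := by
    simp only [EuclideanSpace.norm_sq_eq, Real.norm_eq_abs, sq_abs, PiLp.sub_apply, PiLp.add_apply,
      hx, Finset.mul_sum, ← Finset.sum_sub_distrib, ← Finset.sum_add_distrib]
    exact Finset.sum_congr rfl fun i _ => by ring
  have h2 : ‖θ' - θ‖ ^ 2 ≤ 2 * ‖θ' - θstar‖ ^ 2 + 2 * ‖θ - θstar‖ ^ 2 := by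
    have h3 : ‖θ' - θ‖ ≤ ‖θ' - θstar‖ + ‖θ - θstar‖ := by
      rw [norm_sub_rev θ θstar]
      exact norm_sub_le_norm_sub_add_norm_sub _ _ _
    nlinarith [norm_nonneg (θ' - θ), sq_nonneg (‖θ' - θstar‖ - ‖θ - θstar‖)]
  -- Weighted AM–GM: the weight `1 / 4` lets half of `‖θ' - θstar‖²` be absorbed on the left by
  -- `h2`.
  have h3 : 2 * x ≤ ‖θ' - θ‖ ^ 2 / 4 + 4 * S := by
    refine (le_abs_self _).trans (abs_le_of_sq_le_sq ?_ (by positivity))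
    nlinarith [sq_nonneg (‖θ' - θ‖ ^ 2 / 4 - 4 * S)]
  linarith

lemma risk_le_of_mem_Theta {n k : ℕ} (hk : 1 ≤ k) (hkn : k ≤ n)
    {θ θstar : EuclideanSpace ℝ (Fin n)}
    (hθ : θ ∈ Theta n k) {Z : Fin n → Ω → ℝ} (hZ : IsCenteredIndepNoise P Z) {σ D C' : ℝ}
    (hσ : 0 < σ) {δ : ℕ → ℝ} (hδ0 : ∀ q, 0 ≤ δ q) (hδD : ∀ R, ∑ q ∈ Finset.range R, δ q ≤ D)
    (hL : ∀ i, MemLp (fun ω => Z i ω / σ) 2 P) (hD : ∀ i, ∫ ω, (Z i ω / σ) ^ 2 ∂P ≤ D)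
    (hδ : ∀ i q, ∫ ω, (if 2 ^ q < (Z i ω / σ) ^ 2 then (Z i ω / σ) ^ 2 else 0) ∂P ≤ δ q)
    (hC1 : 13200 * (2 * D + 4) + 4 * D ≤ C') (hC2 : 4096 * (2 * D + 3) ^ 2 ≤ C')
    {fit : ℕ → EuclideanSpace ℝ (Fin n) → EuclideanSpace ℝ (Fin n)}
    {khat : EuclideanSpace ℝ (Fin n) → ℕ}
    (hfit : ∀ k ∈ Finset.Icc 1 n, ∀ x, IsLeastSquares (Theta n k) x (fit k x))
    (hkhat : ∀ x, IsPenalizedChoice (C' * σ ^ 2) (fun k => fit k x) x (khat x)) :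
    risk P θstar Z (fun x => fit (khat x) x) ≤
      ENNReal.ofReal (12 * (‖θ - θstar‖ ^ 2 + pen (C' * σ ^ 2) n k)) := by
  obtain ⟨F, hFI, hF0, hFE, hF⟩ := exists_noise_bound hk hkn hθ hZ hσ hδ0 hδD hL hD hδ
  have hpk := le_pen_one hk hkn
  have hk0 : (0 : ℝ) ≤ k := Nat.cast_nonneg k
  set A := 1024 * (2 * D + 3) ^ 2 with hA
  have hA0 : 0 ≤ A := by positivity
  have hC0 : 0 ≤ C' := by nlinarith
  have hσ2 : 0 < σ ^ 2 := by positivity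
  have hpath : ∀ ω, ‖fit (khat (observation θstar Z ω)) (observation θstar Z ω) - θstar‖ ^ 2 ≤
      3 * ‖θ - θstar‖ ^ 2 + 4 * pen (C' * σ ^ 2) n k + 8 * σ ^ 2 * F ω := fun ω => by
    set x := observation θstar Z ω with hx
    obtain ⟨hmem, hmin⟩ := hkhat x
    set l := khat x with hl
    obtain ⟨hl1, hln⟩ := Finset.mem_Icc.1 hmem
    have hpl := le_pen_one hl1 hln
    have hl0 : (0 : ℝ) ≤ l := Nat.cast_nonneg l
    have h1 : ‖x - fit l x‖ ^ 2 + pen (C' * σ ^ 2) n l ≤ ‖x - θ‖ ^ 2 + pen (C' * σ ^ 2) n k :=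
      (hmin k (Finset.mem_Icc.2 ⟨hk, hkn⟩)).trans
        (add_le_add_left ((hfit k (Finset.mem_Icc.2 ⟨hk, hkn⟩) x).2 θ hθ) _)
    have h2 := sq_dist_le_of_penalized_le (z := WithLp.toLp 2 fun i => Z i ω)
      (mul_nonneg hσ2.le (add_nonneg (hF0 ω) (mul_nonneg hA0
        (add_nonneg (hk0.trans hpk) (hl0.trans hpl)))))
      (hF ω l hl1 hln _ (hfit l hmem x).1) h1
    rw [pen_eq_mul_pen_one (C' * σ ^ 2) n k, pen_eq_mul_pen_one (C' * σ ^ 2) n l] at h2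
    rw [pen_eq_mul_pen_one]
    -- `C' ≥ 4 A` makes `-2 pen l` cancel the noise charge for `l`; what remains for `k` is `4 pen
    -- k`.
    have h3 : 8 * A * σ ^ 2 * (pen 1 n k + pen 1 n l) ≤
        2 * C' * σ ^ 2 * (pen 1 n k + pen 1 n l) := by
      refine mul_le_mul_of_nonneg_right (mul_le_mul_of_nonneg_right (by linarith) hσ2.le) ?_
      linarith
    linarith
  unfold risk
  have hint : Integrable (fun ω => 3 * ‖θ - θstar‖ ^ 2 + 4 * pen (C' * σ ^ 2) n k
      + 8 * σ ^ 2 * F ω) P := (integrable_const _).add (hFI.const_mul _)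
  -- Monotonicity of the lower integral needs no measurability of the estimator.
  refine (lintegral_mono fun ω => ENNReal.ofReal_le_ofReal (hpath ω)).trans ?_
  have hp0 : 0 ≤ pen (C' * σ ^ 2) n k := by
    rw [pen_eq_mul_pen_one]
    exact mul_nonneg (by positivity) (hk0.trans hpk)
  rw [← ofReal_integral_eq_lintegral_ofReal hint (Filter.Eventually.of_forall fun ω => by
    have := hF0 ω
    simp only [Pi.zero_apply]
    positivity)]
  refine ENNReal.ofReal_le_ofReal ?_
  have e := integral_add (integrable_const (μ := P)
    (3 * ‖θ - θstar‖ ^ 2 + 4 * pen (C' * σ ^ 2) n k)) (hFI.const_mul (8 * σ ^ 2))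
  rw [e, integral_const_mul]
  simp only [integral_const, probReal_univ, one_smul]
  have h4 : 8 * σ ^ 2 * ∫ ω, F ω ∂P ≤ 8 * pen (C' * σ ^ 2) n k := by
    rw [pen_eq_mul_pen_one]
    calc 8 * σ ^ 2 * ∫ ω, F ω ∂P ≤ 8 * σ ^ 2 * (C' * pen 1 n k) := by
          refine mul_le_mul_of_nonneg_left (hFE.trans ?_) (by positivity)
          exact mul_le_mul hC1 hpk hk0 hC0
      _ = _ := by ring
  linarith [sq_nonneg ‖θ - θstar‖]

end Risk

/-- The bound passes to the infimum whether or not it is attained. If `r ≠ 0`, the real bounds are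
positive, so the truncation in `ENNReal.ofReal` loses nothing. -/
lemma ofReal_mul_approxError_add {n k : ℕ} (hk : 1 ≤ k) (θstar : EuclideanSpace ℝ (Fin n))
    {C p : ℝ} (hC : 0 < C) {r : ENNReal}
    (h : ∀ θ ∈ Theta n k, r ≤ ENNReal.ofReal (C * (‖θ - θstar‖ ^ 2 + p))) :
    r ≤ ENNReal.ofReal (C * (approxError k θstar + p)) := by
  have : Nonempty (Theta n k) := ⟨⟨0, zero_mem_Theta hk⟩⟩
  by_cases hr : r = 0
  · simp [hr]
  have htop : r ≠ ⊤ := ne_top_of_le_ne_top ENNReal.ofReal_ne_top (h 0 (zero_mem_Theta hk))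
  have hpos : ∀ θ ∈ Theta n k, r.toReal ≤ C * (‖θ - θstar‖ ^ 2 + p) := fun θ hθ => by
    have h1 := h θ hθ
    have h2 : 0 < C * (‖θ - θstar‖ ^ 2 + p) := by
      by_contra hneg
      rw [ENNReal.ofReal_of_nonpos (not_lt.1 hneg)] at h1
      exact hr (le_antisymm h1 bot_le)
    exact ENNReal.toReal_le_of_le_ofReal h2.le h1
  refine ENNReal.le_ofReal_iff_toReal_le htop ?_ |>.2 ?_
  all_goals
    have h3 : r.toReal / C - p ≤ approxError k θstar := le_ciInf fun θ => by
      have := hpos θ θ.2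
      rw [sub_le_iff_le_add, div_le_iff₀ hC]
      linarith
    have h4 : r.toReal ≤ C * (approxError k θstar + p) := by
      rw [sub_le_iff_le_add, div_le_iff₀ hC] at h3
      linarith
  · exact ENNReal.toReal_nonneg.trans h4
  · exact h4

end ReducedIsotonic

theorem theorem3p1 (ε C₁ : ℝ) (hε : 0 < ε) (hε1 : ε < 1) (hC₁ : 0 < C₁) :
    ∃ C₀ > (0 : ℝ), ∃ C > (0 : ℝ), ∀ C' ≥ C₀,
      ∀ (n : ℕ) (hn : 1 ≤ n) (Ω : Type*) [MeasurableSpace Ω] (P : Measure Ω)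
        [IsProbabilityMeasure P] (Z : Fin n → Ω → ℝ) (θstar : EuclideanSpace ℝ (Fin n))
        (σ τ : ℝ) (fit : ℕ → EuclideanSpace ℝ (Fin n) → EuclideanSpace ℝ (Fin n))
        (khat : EuclideanSpace ℝ (Fin n) → ℕ),
        0 < σ →
        ReducedIsotonic.IsCenteredIndepNoise P Z →
        ReducedIsotonic.MomentCondition P Z σ ε C₁ →
        τ = C' * σ ^ 2 →
        (∀ k ∈ Finset.Icc 1 n, ∀ x,
          ReducedIsotonic.IsLeastSquares (ReducedIsotonic.Theta n k) x (fit k x)) →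
        (∀ x, ReducedIsotonic.IsPenalizedChoice τ (fun k => fit k x) x (khat x)) →
        ReducedIsotonic.risk P θstar Z (fun x => fit (khat x) x) ≤
            ENNReal.ofReal (C * ReducedIsotonic.oracleRisk hn τ θstar) ∧
          ∀ k ∈ Finset.Icc 1 n, θstar ∈ ReducedIsotonic.Theta n k →
            ReducedIsotonic.risk P θstar Z (fun x => fit (khat x) x) ≤
              ENNReal.ofReal (C * ReducedIsotonic.pen τ n k) := by
  set D : ℝ := 1 + 3 * C₁ + C₁ / (1 - 2 ^ (-(ε / 2))) with hD
  have hx1 : (2 : ℝ) ^ (-(ε / 2)) < 1 :=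
    Real.rpow_lt_one_of_one_lt_of_neg (by norm_num) (by linarith)
  have hD0 : 0 < D := by
    have : 0 < C₁ / (1 - 2 ^ (-(ε / 2))) := div_pos hC₁ (by linarith)
    positivity
  -- The threshold adds the two requirements on `C'`: domination of the mean of `F` and absorption
  -- of the penalty of the selected model. The factor `12` is `4 + 8` from the two penalty terms.
  refine ⟨13200 * (2 * D + 4) + 4 * D + 4096 * (2 * D + 3) ^ 2, by positivity, 12, by norm_num, ?_⟩
  intro C' hC' n hn Ω _ P _ Z θstar σ τ fit khat hσ hZ hmom hτ hfit hkhat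
  subst hτ
  obtain ⟨δ, hδ0, hδD, hL, hvar, hδ⟩ := hmom.exists_tail_bound hn hZ.measurable hε hC₁
  have hsq : 0 ≤ 4096 * (2 * D + 3) ^ 2 := by positivity
  have hmain : ∀ k ∈ Finset.Icc 1 n, ∀ θ ∈ ReducedIsotonic.Theta n k,
      ReducedIsotonic.risk P θstar Z (fun x => fit (khat x) x) ≤
        ENNReal.ofReal (12 * (‖θ - θstar‖ ^ 2 + ReducedIsotonic.pen (C' * σ ^ 2) n k)) :=
    fun k hk θ hθ => ReducedIsotonic.risk_le_of_mem_Theta (Finset.mem_Icc.1 hk).1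
      (Finset.mem_Icc.1 hk).2 hθ hZ hσ hδ0 hδD hL hvar hδ (by linarith)
      (by linarith) hfit hkhat
  refine ⟨?_, fun k hk hθ => by simpa using hmain k hk θstar hθ⟩
  obtain ⟨k, hk, he⟩ := Finset.exists_mem_eq_inf' (Finset.nonempty_Icc.mpr hn) fun k =>
    ReducedIsotonic.approxError k θstar + ReducedIsotonic.pen (C' * σ ^ 2) n k
  unfold ReducedIsotonic.oracleRisk
  rw [he]
  exact ReducedIsotonic.ofReal_mul_approxError_add (Finset.mem_Icc.1 hk).1 θstar (by norm_num)
    (hmain k hk)
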